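/- Let $\mu$ be a probability measure on the unit circle $\{|z|=1\}$ that is not supported on a finite set. Let $\Phi_n$ be its monic orthogonal polynomials, $\varphi_n=\Phi_n/\|\Phi_n\|_{L^2(\mu)}$ its orthonormal polynomials, and $\alpha_n=-\overline{\Phi_{n+1}(0)}$ its Verblunsky coefficients. Write $d\mu=w\,\frac{d\theta}{2\pi}+d\mu_s$ for the Lebesgue decomposition, and let $$D(z)=\exp\Bigl(\frac1{4\pi}\int_0^{2\pi}\frac{e^{i\theta}+z}{e^{i\theta}-z}\,\log w(e^{i\theta})\,d\theta\Bigr),\qquad |z|<1,$$ be the Szegő function. Assume that $\lim_{n\to\infty}|\alpha_n|^{1/n}=b$ with $b<1$. Then the Szegő condition holds, i.e. $w>0$ almost everywhere and $\log w$ is integrable, and $D(z)^{-1}$ has a (unique) analytic continuation, still denoted $D(z)^{-1}$, to the disk $\{|z|<b^{-1}\}$ (to all of $\mathbb C$ if $b=0$). Moreover, let $z_0$ be a Nevai–Totik zero, that is, $|z_0|>b$ and $D(1/\bar z_0)^{-1}=0$, and let $k\ge 1$ be the order of the zero of $z\mapsto\overline{D(1/\bar z)}^{\,-1}$ at $z_0$.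 Then there are $\delta>0$, $\varepsilon>0$ and $N$ such that for all $n\ge N$ the polynomial $\varphi_n$ has exactly $k$ zeros, counted with multiplicity (in particular at least one), in $\{|z-z_0|<\delta\}$, and every such zero $z_n$ satisfies $$|z_n-z_0|\le e^{-\varepsilon n}.$$ -/

import Mathlib

open MeasureTheory Filter Topology Polynomial
open scoped ComplexConjugate

namespace OPUC

noncomputable section

/-- Normalized arc length `dθ / 2π` on the unit circle, as a Borel measure on `ℂ`. -/
def arcMeasure : Measure ℂ :=
  ENNReal.ofReal (2 * Real.pi)⁻¹ •
    (volume.restrict (Set.Ioc (0 : ℝ) (2 * Real.pi))).map (circleMap 0 1)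

/-- A nontrivial probability measure on the unit circle: it is carried by the circle and is not
supported on a finite set. -/
structure IsNontrivialCircleMeasure (μ : Measure ℂ) : Prop where
  isProbabilityMeasure : IsProbabilityMeasure μ
  carried_by_circle : μ (Metric.sphere (0 : ℂ) 1)ᶜ = 0
  not_finitely_supported : ∀ s : Set ℂ, s.Finite → μ sᶜ ≠ 0

/-- The inner product `⟨p, q⟩ = ∫ conj p · q dμ` of `L²(μ)` on polynomials. -/
def polyInner (μ : Measure ℂ) (p q : ℂ[X]) : ℂ :=
  ∫ ζ, conj (p.eval ζ) * q.eval ζ ∂μ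

/-- The norm of a polynomial in `L²(μ)`. -/
def polyNorm (μ : Measure ℂ) (p : ℂ[X]) : ℝ :=
  Real.sqrt (∫ ζ, ‖p.eval ζ‖ ^ 2 ∂μ)

/-- The monic orthogonal polynomials `Φ_n` of `μ`: Gram–Schmidt applied to `1, z, z², …`. -/
def monicOP (μ : Measure ℂ) (n : ℕ) : ℂ[X] :=
  X ^ n - ∑ k : Fin n,
    C (polyInner μ (monicOP μ k) (X ^ n) / polyInner μ (monicOP μ k) (monicOP μ k)) *
      monicOP μ k
termination_by n
decreasing_by exact k.2

/-- The orthonormal polynomials `φ_n = Φ_n / ‖Φ_n‖`. -/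
def orthonormalOP (μ : Measure ℂ) (n : ℕ) : ℂ[X] :=
  C ((polyNorm μ (monicOP μ n) : ℂ)⁻¹) * monicOP μ n

/-- The Verblunsky coefficients `α_n = - conj (Φ_{n+1}(0))`. -/
def verblunsky (μ : Measure ℂ) (n : ℕ) : ℂ :=
  -conj ((monicOP μ (n + 1)).eval 0)

/-- The density `w` in the Lebesgue decomposition `dμ = w dθ/2π + dμ_s`. -/
def acDensity (μ : Measure ℂ) (ζ : ℂ) : ℝ :=
  (μ.rnDeriv arcMeasure ζ).toReal

/-- The Szegő condition `∫ log w dθ/2π > -∞`: the density is positive almost everywhere on the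
circle and `log w` is integrable. Positivity is stated separately because `Real.log 0 = 0`. -/
def SzegoCondition (μ : Measure ℂ) : Prop :=
  (∀ᵐ ζ ∂arcMeasure, 0 < acDensity μ ζ) ∧
    Integrable (fun ζ => Real.log (acDensity μ ζ)) arcMeasure

/-- The Szegő function
`D(z) = exp ((1/4π) ∫ (e^{iθ} + z) / (e^{iθ} - z) log w(e^{iθ}) dθ)`, for `|z| < 1`. -/
def szegoD (μ : Measure ℂ) (z : ℂ) : ℂ :=
  Complex.exp ((1 / 2 : ℂ) *
    ∫ ζ, (ζ + z) / (ζ - z) * (Real.log (acDensity μ ζ) : ℂ) ∂arcMeasure)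

/-- `G` is the analytic continuation of `D⁻¹` from the unit disk to `{|z| < 1/b}` (to all of `ℂ`
if `b = 0`). For `0 ≤ b ≤ 1` it is unique on that disk. -/
structure IsSzegoInvContinuation (μ : Measure ℂ) (b : ℝ) (G : ℂ → ℂ) : Prop where
  differentiableOn : DifferentiableOn ℂ G {z : ℂ | b * ‖z‖ < 1}
  eq_inv : ∀ z : ℂ, ‖z‖ < 1 → G z = (szegoD μ z)⁻¹

/-- The number of zeros of `p` in the open disk of radius `δ` about `z₀`, counted with
multiplicity. -/
def zeroCount (p : ℂ[X]) (z₀ : ℂ) (δ : ℝ) : ℕ :=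
  p.roots.countP (fun z => ‖z - z₀‖ < δ)

end

end OPUC

/-! The reversed polynomials satisfy Φ*_{n+1} - Φ*_n = -α_n z Φ_n (`eval_revOP_succ`). On |z| ≤ R
with R ≥ 1 one has |Φ_n| ≤ C R^n, while |α_n| ≤ K β^n for any β > b. If bR < 1, choosing β < 1/R
makes the increments geometrically small, so Φ*_n converges geometrically to an analytic S on {b|z|
< 1} (`exists_limit_revOP`). Since |Φ_n| ≤ |Φ*_n| on the closed unit disk and Σ|α_n| < ∞, S has no
zero there (`limit_revOP_ne_zero`).

S is identified through moments. As Φ*_n is orthogonal to z, …, z^n, passing to the limit gives ∫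
|S|² ζ^k dμ = 0 for k ≥ 1 (`integral_limit_revOP`). Hence |S|² dμ = A dθ/2π, so w = A/|S|² is
bounded away from 0 and ∞ on the circle, and the Szegő condition follows. With G = S/√A, w = |G|⁻²,
and the Schwarz formula applied to log G yields D⁻¹ = G (`inv_szegoD_eq`).

Finally Φ_n(z) = z^n conj(Φ*_n(1/conj z)), so z^{-n} Φ_n(z) is, up to a constant, geometrically
close near z₀ to F(z) = conj(G(1/conj z)). Rouché's theorem gives k zeros. At such a zero |z - z₀|^k
is at most a constant times q^n with q < 1, which is the exponential rate (`exists_zeros_near`). -/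

namespace OPUC

/-! ### Reversal, orthogonality and the Szegő recursion. -/

/-- A function continuous on the unit circle is integrable against a finite measure carried by
the circle. -/
lemma integrable_of_continuousOn_sphere {E : Type*} [NormedAddCommGroup E] {μ : Measure ℂ}
    [IsFiniteMeasure μ] (hμ : μ (Metric.sphere (0 : ℂ) 1)ᶜ = 0) {f : ℂ → E}
    (hf : ContinuousOn f (Metric.sphere (0 : ℂ) 1)) : Integrable f μ := by
  have h : μ.restrict (Metric.sphere (0 : ℂ) 1) = μ :=
    Measure.restrict_eq_self_of_ae_mem (by rwa [ae_iff])
  have := hf.integrableOn_compact (μ := μ) (isCompact_sphere _ _)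
  rwa [IntegrableOn, h] at this

lemma ae_norm_eq_one {μ : Measure ℂ} (hμ : μ (Metric.sphere (0 : ℂ) 1)ᶜ = 0) :
    ∀ᵐ ζ ∂μ, ‖ζ‖ = 1 := by
  filter_upwards [compl_mem_ae_iff.2 hμ] with ζ hζ
  simpa using hζ

/-- The reversed polynomial `p^*(z) = z^n conj (p (1 / conj z))` of a polynomial of degree at most
`n`. -/
noncomputable def revPoly (n : ℕ) (p : ℂ[X]) : ℂ[X] :=
  (p.map (starRingEnd ℂ)).reflect n

lemma conj_eval (p : ℂ[X]) (z : ℂ) :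
    conj (p.eval z) = (p.map (starRingEnd ℂ)).eval (conj z) := by
  rw [eval_map, eval₂_at_apply]

lemma eval_revPoly {n : ℕ} {p : ℂ[X]} (hp : p.natDegree ≤ n) {z : ℂ} (hz : z ≠ 0) :
    (revPoly n p).eval z = z ^ n * conj (p.eval (1 / conj z)) := by
  have hz' : z⁻¹ ≠ 0 := inv_ne_zero hz
  let _ : Invertible z⁻¹ := invertibleOfNonzero hz'
  have h := eval₂_reflect_mul_pow (RingHom.id ℂ) z⁻¹ n (p.map (starRingEnd ℂ))
    (natDegree_map_le.trans hp)
  rw [invOf_eq_inv, inv_inv] at h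
  rw [conj_eval]
  simp only [one_div, map_inv₀, Complex.conj_conj, revPoly]
  rw [eval, eval, ← h, inv_pow]
  field_simp

lemma natDegree_revPoly_le {n : ℕ} {p : ℂ[X]} (hp : p.natDegree ≤ n) :
    (revPoly n p).natDegree ≤ n := by
  refine natDegree_reflect_le.trans (max_le le_rfl (natDegree_map_le.trans hp))

lemma eval_zero_revPoly (n : ℕ) (p : ℂ[X]) : (revPoly n p).eval 0 = conj (p.coeff n) := by
  rw [← coeff_zero_eq_eval_zero, revPoly, coeff_reflect]
  simp [revAt_le]

lemma eval_revPoly_of_norm_eq_one {n : ℕ} {p : ℂ[X]} (hp : p.natDegree ≤ n) {z : ℂ}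
    (hz : ‖z‖ = 1) : (revPoly n p).eval z = z ^ n * conj (p.eval z) := by
  have hz0 : z ≠ 0 := by rintro rfl; simp at hz
  have : (1 : ℂ) / conj z = z := by
    have := Complex.mul_conj z
    rw [Complex.normSq_eq_norm_sq, hz] at this
    have h0 : conj z ≠ 0 := by simpa using hz0
    field_simp
    simpa [mul_comm] using this.symm
  rw [eval_revPoly hp hz0, this]

section Inner

variable {μ : Measure ℂ}

lemma polyInner_conj_symm (p q : ℂ[X]) : conj (polyInner μ p q) = polyInner μ q p := by
  rw [polyInner, polyInner, ← integral_conj]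
  congr 1; ext ζ; simp [mul_comm]


lemma integrable_polyInner (hμ : IsNontrivialCircleMeasure μ) (p q : ℂ[X]) :
    Integrable (fun ζ => conj (p.eval ζ) * q.eval ζ) μ := by
  have := hμ.isProbabilityMeasure
  exact integrable_of_continuousOn_sphere hμ.carried_by_circle (by fun_prop)

lemma polyInner_add (hμ : IsNontrivialCircleMeasure μ) (p q r : ℂ[X]) :
    polyInner μ p (q + r) = polyInner μ p q + polyInner μ p r := by
  rw [polyInner, polyInner, polyInner,
    ← integral_add (integrable_polyInner hμ p q) (integrable_polyInner hμ p r)]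
  congr 1; ext ζ; simp [mul_add]

lemma polyInner_C_mul (p q : ℂ[X]) (c : ℂ) :
    polyInner μ p (C c * q) = c * polyInner μ p q := by
  rw [polyInner, polyInner, ← integral_const_mul]
  congr 1; ext ζ; simp; ring

lemma polyInner_sub (hμ : IsNontrivialCircleMeasure μ) (p q r : ℂ[X]) :
    polyInner μ p (q - r) = polyInner μ p q - polyInner μ p r := by
  rw [polyInner, polyInner, polyInner,
    ← integral_sub (integrable_polyInner hμ p q) (integrable_polyInner hμ p r)]
  congr 1; ext ζ; simp [mul_sub]

lemma polyInner_sum (hμ : IsNontrivialCircleMeasure μ) {ι : Type*} (s : Finset ι)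
    (p : ℂ[X]) (q : ι → ℂ[X]) :
    polyInner μ p (∑ i ∈ s, q i) = ∑ i ∈ s, polyInner μ p (q i) := by
  simp only [polyInner]
  rw [← integral_finsetSum _ fun i _ => integrable_polyInner hμ p (q i)]
  congr 1; ext ζ; simp [eval_finsetSum, Finset.mul_sum]

lemma polyInner_X_mul (hμ : IsNontrivialCircleMeasure μ) (p q : ℂ[X]) :
    polyInner μ (X * p) (X * q) = polyInner μ p q := by
  refine integral_congr_ae ?_
  filter_upwards [ae_norm_eq_one hμ.carried_by_circle] with ζ hζ
  have : conj ζ * ζ = 1 := by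
    rw [← Complex.normSq_eq_conj_mul_self, Complex.normSq_eq_norm_sq, hζ]; simp
  simp only [eval_mul, eval_X, map_mul]
  linear_combination conj (p.eval ζ) * q.eval ζ * this

lemma polyInner_self (p : ℂ[X]) :
    polyInner μ p p = ((∫ ζ, ‖p.eval ζ‖ ^ 2 ∂μ : ℝ) : ℂ) := by
  rw [polyInner, ← integral_complex_ofReal]
  congr 1; ext ζ
  rw [← Complex.normSq_eq_conj_mul_self, Complex.normSq_eq_norm_sq]

/-- The zeros of `p` form a finite set, whose complement has positive measure. This is where
nontriviality of `μ` enters. -/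
lemma integral_norm_sq_pos (hμ : IsNontrivialCircleMeasure μ) {p : ℂ[X]} (hp : p ≠ 0) :
    0 < ∫ ζ, ‖p.eval ζ‖ ^ 2 ∂μ := by
  have := hμ.isProbabilityMeasure
  rw [integral_pos_iff_support_of_nonneg (fun _ => by positivity)
    (integrable_of_continuousOn_sphere hμ.carried_by_circle (by fun_prop))]
  have h := hμ.not_finitely_supported {z | p.IsRoot z} (finite_setOfPred_isRoot hp)
  convert pos_iff_ne_zero.2 h using 2
  ext z
  simp [IsRoot]

lemma polyInner_self_ne_zero (hμ : IsNontrivialCircleMeasure μ) {p : ℂ[X]} (hp : p ≠ 0) :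
    polyInner μ p p ≠ 0 := by
  rw [polyInner_self]
  exact_mod_cast (integral_norm_sq_pos hμ hp).ne'

lemma eq_zero_of_polyInner_self (hμ : IsNontrivialCircleMeasure μ) {p : ℂ[X]}
    (h : polyInner μ p p = 0) : p = 0 := by
  by_contra hp
  exact polyInner_self_ne_zero hμ hp h

lemma monicOP_monic (μ : Measure ℂ) (n : ℕ) :
    (monicOP μ n).Monic ∧ (monicOP μ n).natDegree = n := by
  induction n using Nat.strong_induction_on with
  | _ n ih =>
    have hdeg : (∑ k : Fin n,
        C (polyInner μ (monicOP μ k) (X ^ n) / polyInner μ (monicOP μ k) (monicOP μ k)) *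
          monicOP μ k).degree < n := by
      refine (degree_sum_le _ _).trans_lt ?_
      refine (Finset.sup_lt_iff (WithBot.bot_lt_coe n)).2 ?_
      intro k _
      refine degree_le_natDegree.trans_lt ?_
      refine (WithBot.coe_le_coe.2 (natDegree_C_mul_le _ _)).trans_lt ?_
      rw [(ih k k.2).2]
      exact_mod_cast k.2
    rw [monicOP]
    refine ⟨monic_X_pow_sub hdeg, natDegree_eq_of_degree_eq_some ?_⟩
    rw [degree_sub_eq_left_of_degree_lt (by simpa using hdeg), degree_X_pow]

lemma natDegree_monicOP (μ : Measure ℂ) (n : ℕ) : (monicOP μ n).natDegree = n :=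
  (monicOP_monic μ n).2

lemma monicOP_ne_zero (μ : Measure ℂ) (n : ℕ) : monicOP μ n ≠ 0 := (monicOP_monic μ n).1.ne_zero

lemma polyInner_monicOP_of_lt (hμ : IsNontrivialCircleMeasure μ) {k n : ℕ} (hk : k < n) :
    polyInner μ (monicOP μ k) (monicOP μ n) = 0 := by
  induction n using Nat.strong_induction_on generalizing k with
  | _ n ih =>
    have hne : ∀ i j, i < n → j < n → i ≠ j →
        polyInner μ (monicOP μ i) (monicOP μ j) = 0 := by
      intro i j hi hj hij
      rcases hij.lt_or_gt with h | h
      · exact ih j hj h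
      · rw [← polyInner_conj_symm, ih i hi h, map_zero]
    conv_lhs => rw [monicOP.eq_1 μ n]
    rw [polyInner_sub hμ, polyInner_sum hμ, Finset.sum_eq_single ⟨k, hk⟩]
    · rw [polyInner_C_mul,
        div_mul_cancel₀ _ (polyInner_self_ne_zero hμ (monicOP_ne_zero μ k)), sub_self]
    · intro j _ hj
      rw [polyInner_C_mul, hne k j hk j.2 (fun h => hj (Fin.ext h.symm)), mul_zero]
    · simp

lemma polyInner_monicOP_X_pow (hμ : IsNontrivialCircleMeasure μ) {m n : ℕ} (hm : m < n) :
    polyInner μ (monicOP μ n) (X ^ m) = 0 := by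
  have h0 : ∀ k, k < n → polyInner μ (monicOP μ n) (monicOP μ k) = 0 := fun k hk => by
    rw [← polyInner_conj_symm, polyInner_monicOP_of_lt hμ hk, map_zero]
  -- Gram–Schmidt read backwards: `X ^ m` is Φ_m plus a combination of the earlier Φ_k.
  have h := sub_eq_iff_eq_add.1 (monicOP.eq_1 μ m).symm
  rw [h, polyInner_add hμ, h0 m hm, polyInner_sum hμ, zero_add]
  refine Finset.sum_eq_zero fun k _ => ?_
  rw [polyInner_C_mul, h0 k (k.2.trans hm), mul_zero]

/-- The reversed monic orthogonal polynomial `Φ_n^*`. -/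
noncomputable def revOP (μ : Measure ℂ) (n : ℕ) : ℂ[X] := revPoly n (monicOP μ n)

lemma eval_zero_revOP (μ : Measure ℂ) (n : ℕ) : (revOP μ n).eval 0 = 1 := by
  have h := (monicOP_monic μ n).1.coeff_natDegree
  rw [natDegree_monicOP] at h
  rw [revOP, eval_zero_revPoly, h, map_one]

lemma eval_revOP {n : ℕ} {z : ℂ} (hz : z ≠ 0) :
    (revOP μ n).eval z = z ^ n * conj ((monicOP μ n).eval (1 / conj z)) :=
  eval_revPoly (natDegree_monicOP μ n).le hz

lemma eval_revOP_of_norm_eq_one {n : ℕ} {z : ℂ} (hz : ‖z‖ = 1) :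
    (revOP μ n).eval z = z ^ n * conj ((monicOP μ n).eval z) :=
  eval_revPoly_of_norm_eq_one (natDegree_monicOP μ n).le hz

lemma natDegree_revOP_le (μ : Measure ℂ) (n : ℕ) : (revOP μ n).natDegree ≤ n :=
  natDegree_revPoly_le (natDegree_monicOP μ n).le

/-- On the circle, reversal turns ⟨z^k, Φ*_n⟩ into ⟨Φ_n, z^{n-k}⟩, and n - k < n exactly because k ≥
1. -/
lemma polyInner_revOP_X_pow (hμ : IsNontrivialCircleMeasure μ) {k n : ℕ} (hk : 1 ≤ k)
    (hkn : k ≤ n) :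
    polyInner μ (revOP μ n) (X ^ k) = 0 := by
  rw [← polyInner_conj_symm,
    show polyInner μ (X ^ k) (revOP μ n) = polyInner μ (monicOP μ n) (X ^ (n - k)) from ?_,
    polyInner_monicOP_X_pow hμ (by omega), map_zero]
  refine integral_congr_ae ?_
  filter_upwards [ae_norm_eq_one hμ.carried_by_circle] with ζ hζ
  have h1 : conj ζ * ζ = 1 := by
    rw [← Complex.normSq_eq_conj_mul_self, Complex.normSq_eq_norm_sq, hζ]; simp
  rw [eval_revOP_of_norm_eq_one hζ]
  obtain ⟨m, rfl⟩ := Nat.exists_eq_add_of_le hkn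
  simp only [eval_pow, eval_X, map_pow, Nat.add_sub_cancel_left, pow_add]
  have h2 : conj ζ ^ k * ζ ^ k = 1 := by rw [← mul_pow, h1, one_pow]
  linear_combination (ζ ^ m * conj ((monicOP μ (k + m)).eval ζ)) * h2

/-- If `p` is orthogonal to `X, …, X^m`, it is orthogonal to every polynomial of degree at most `m`
vanishing at `0`. -/
lemma polyInner_eq_zero_of_eval_zero (hμ : IsNontrivialCircleMeasure μ) {m : ℕ} {p q : ℂ[X]}
    (hp : ∀ k, 1 ≤ k → k ≤ m → polyInner μ p (X ^ k) = 0) (hq : q.natDegree ≤ m)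
    (h0 : q.eval 0 = 0) : polyInner μ p q = 0 := by
  rw [q.as_sum_range_C_mul_X_pow, polyInner_sum hμ]
  refine Finset.sum_eq_zero fun k hk => ?_
  rw [polyInner_C_mul]
  rcases Nat.eq_zero_or_pos k with rfl | hpos
  · rw [coeff_zero_eq_eval_zero, h0, zero_mul]
  · rw [hp k hpos (by simp at hk; omega), mul_zero]

/-- `Φ_n` is orthogonal to every polynomial of degree less than `n`. -/
lemma polyInner_monicOP_of_natDegree_lt (hμ : IsNontrivialCircleMeasure μ) {n : ℕ} {q : ℂ[X]}
    (hq : q.natDegree < n) : polyInner μ (monicOP μ n) q = 0 := by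
  rw [q.as_sum_range_C_mul_X_pow, polyInner_sum hμ]
  refine Finset.sum_eq_zero fun k hk => ?_
  rw [polyInner_C_mul, polyInner_monicOP_X_pow hμ (by simp at hk; omega), mul_zero]

lemma polyInner_revOP_self (hμ : IsNontrivialCircleMeasure μ) (n : ℕ) :
    polyInner μ (revOP μ n) (revOP μ n) = polyInner μ (monicOP μ n) (monicOP μ n) := by
  rw [polyInner_self, polyInner_self]
  congr 1
  refine integral_congr_ae ?_
  filter_upwards [ae_norm_eq_one hμ.carried_by_circle] with ζ hζ
  simp [eval_revOP_of_norm_eq_one hζ, hζ]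

/-- **Szegő recursion** for the monic orthogonal polynomials. -/
lemma monicOP_succ (hμ : IsNontrivialCircleMeasure μ) (n : ℕ) :
    monicOP μ (n + 1) = X * monicOP μ n - C (conj (verblunsky μ n)) * revOP μ n := by
  -- `Q` has degree at most `n` (leading terms cancel), vanishes at 0 by the choice of α_n, and is
  -- orthogonal to X, …, X^n. It is therefore orthogonal to itself.
  set Q : ℂ[X] := X * monicOP μ n - C (conj (verblunsky μ n)) * revOP μ n - monicOP μ (n + 1)
    with hQ
  suffices h : Q = 0 from (sub_eq_zero.1 h).symm
  have hmon : (X * monicOP μ n).Monic := monic_X.mul (monicOP_monic μ n).1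
  have hnat : (X * monicOP μ n).natDegree = n + 1 := by
    rw [natDegree_X_mul (monicOP_ne_zero μ n), natDegree_monicOP]
  have hdeg : (X * monicOP μ n - monicOP μ (n + 1)).natDegree ≤ n := by
    have := degree_sub_lt_left (p := X * monicOP μ n) (q := monicOP μ (n + 1))
      (by rw [degree_eq_natDegree hmon.ne_zero, hnat,
        degree_eq_natDegree (monicOP_ne_zero μ _), natDegree_monicOP]) hmon.ne_zero
      (by rw [hmon.leadingCoeff, (monicOP_monic μ _).1.leadingCoeff])
    rw [degree_eq_natDegree hmon.ne_zero, hnat] at this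
    exact natDegree_le_of_degree_le (Order.le_of_lt_succ (by exact_mod_cast this))
  have hQdeg : Q.natDegree ≤ n := by
    have : Q = (X * monicOP μ n - monicOP μ (n + 1)) -
        C (conj (verblunsky μ n)) * revOP μ n := by rw [hQ]; ring
    rw [this]
    exact (natDegree_sub_le _ _).trans (max_le hdeg
      ((natDegree_C_mul_le _ _).trans (natDegree_revOP_le μ n)))
  have hQ0 : Q.eval 0 = 0 := by
    simp [hQ, verblunsky, eval_zero_revOP]
  have hXQ : ∀ k, 1 ≤ k → k ≤ n → polyInner μ Q (X ^ k) = 0 := by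
    intro k hk hkn
    rw [← polyInner_conj_symm, hQ, polyInner_sub hμ, polyInner_sub hμ, polyInner_C_mul]
    have e1 : polyInner μ (X ^ k) (revOP μ n) = 0 := by
      rw [← polyInner_conj_symm, polyInner_revOP_X_pow hμ hk hkn, map_zero]
    have e2 : polyInner μ (X ^ k) (monicOP μ (n + 1)) = 0 := by
      rw [← polyInner_conj_symm, polyInner_monicOP_X_pow hμ (by omega), map_zero]
    have e3 : polyInner μ (X ^ k) (X * monicOP μ n) = 0 := by
      obtain ⟨j, rfl⟩ := Nat.exists_eq_add_of_le' hk
      rw [pow_succ', polyInner_X_mul hμ, ← polyInner_conj_symm,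
        polyInner_monicOP_X_pow hμ (by omega), map_zero]
    rw [e1, e2, e3]; simp
  exact eq_zero_of_polyInner_self hμ (polyInner_eq_zero_of_eval_zero hμ hXQ hQdeg hQ0)

/-- **Szegő recursion** for the reversed polynomials. -/
lemma eval_revOP_succ (hμ : IsNontrivialCircleMeasure μ) (n : ℕ) (z : ℂ) :
    (revOP μ (n + 1)).eval z =
      (revOP μ n).eval z - verblunsky μ n * (z * (monicOP μ n).eval z) := by
  rcases eq_or_ne z 0 with rfl | hz
  · simp [eval_zero_revOP]
  have hz' : (1 : ℂ) / conj z ≠ 0 := by simpa using hz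
  have h : conj ((revOP μ n).eval (1 / conj z)) = (z ^ n)⁻¹ * (monicOP μ n).eval z := by
    rw [eval_revOP hz']
    simp
  rw [eval_revOP hz, monicOP_succ hμ, eval_revOP hz]
  simp only [eval_sub, eval_mul, eval_X, eval_C, map_sub, map_mul, h, map_div₀, map_one,
    Complex.conj_conj]
  field_simp
  ring

/-- Pythagoras: in zΦ_n = Φ_{n+1} + conj(α_n) Φ*_n the two terms on the right are orthogonal, so
‖Φ_{n+1}‖² = (1 - |α_n|²)‖Φ_n‖², and both norms are positive. -/
lemma norm_verblunsky_lt_one (hμ : IsNontrivialCircleMeasure μ) (n : ℕ) :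
    ‖verblunsky μ n‖ < 1 := by
  set c := conj (verblunsky μ n) with hc
  have h1 : X * monicOP μ n = monicOP μ (n + 1) + C c * revOP μ n := by
    rw [monicOP_succ hμ]; ring
  have h2 : polyInner μ (monicOP μ (n + 1)) (revOP μ n) = 0 :=
    polyInner_monicOP_of_natDegree_lt hμ (Nat.lt_succ_of_le (natDegree_revOP_le μ n))
  have h2' : polyInner μ (revOP μ n) (monicOP μ (n + 1)) = 0 := by
    rw [← polyInner_conj_symm, h2, map_zero]
  have h3 : polyInner μ (X * monicOP μ n) (monicOP μ (n + 1)) =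
      polyInner μ (monicOP μ (n + 1)) (monicOP μ (n + 1)) := by
    rw [← polyInner_conj_symm, h1, polyInner_add hμ, polyInner_C_mul, h2, mul_zero, add_zero,
      polyInner_conj_symm]
  have h4 : polyInner μ (X * monicOP μ n) (revOP μ n) =
      conj c * polyInner μ (revOP μ n) (revOP μ n) := by
    rw [← polyInner_conj_symm, h1, polyInner_add hμ, polyInner_C_mul, h2', zero_add, map_mul,
      polyInner_conj_symm]
  have h5 := polyInner_X_mul hμ (monicOP μ n) (monicOP μ n)
  conv_lhs at h5 => arg 3; rw [h1]
  rw [polyInner_add hμ, polyInner_C_mul, h3, h4, polyInner_revOP_self hμ, polyInner_self,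
    polyInner_self, ← mul_assoc, Complex.mul_conj, Complex.normSq_eq_norm_sq] at h5
  have h6 : ‖c‖ = ‖verblunsky μ n‖ := by rw [hc, RCLike.norm_conj]
  rw [h6] at h5
  norm_cast at h5
  have hA := integral_norm_sq_pos hμ (monicOP_ne_zero μ (n + 1))
  have hB := integral_norm_sq_pos hμ (monicOP_ne_zero μ n)
  by_contra! hge
  have : 1 ≤ ‖verblunsky μ n‖ ^ 2 := one_le_pow₀ hge
  nlinarith

end Inner

/-! ### Growth and geometric convergence of the reversed polynomials. -/

lemma exists_norm_le_mul_pow_of_tendsto_root {a : ℕ → ℂ} {b β : ℝ} (hbβ : b < β) (hβ : 0 < β)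
    (ha : Tendsto (fun n : ℕ => ‖a n‖ ^ (1 / (n : ℝ))) atTop (𝓝 b)) :
    ∃ K > 0, ∀ n, ‖a n‖ ≤ K * β ^ n := by
  have hO : a =O[atTop] fun n => β ^ n := by
    refine Asymptotics.IsBigO.of_bound 1 ?_
    -- At `n = 0` the exponent `1 / n` is 0, so the root can only be undone for `n ≥ 1`.
    filter_upwards [ha.eventually_lt_const hbβ, eventually_ge_atTop 1] with n hn hn1
    have hn0 : n ≠ 0 := by omega
    have := pow_le_pow_left₀ (by positivity) hn.le n
    rw [one_div, Real.rpow_inv_natCast_pow (norm_nonneg _) hn0] at this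
    simpa [abs_of_pos hβ] using this
  obtain ⟨K, hK, h⟩ := Asymptotics.bound_of_isBigO_nat_atTop hO
  refine ⟨K, hK, fun n => ?_⟩
  simpa [abs_of_pos hβ] using h (x := n) (by positivity)

section

variable {μ : Measure ℂ}

/-- The bound is proved for Φ_n and Φ*_n together: each step of the coupled recursion costs at most
a factor (1 + |α_n|) R. -/
lemma norm_eval_monicOP_le (hμ : IsNontrivialCircleMeasure μ)
    (hs : Summable fun n => ‖verblunsky μ n‖) {R : ℝ} (hR : 1 ≤ R) {z : ℂ} (hz : ‖z‖ ≤ R) (n : ℕ) :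
    ‖(monicOP μ n).eval z‖ ≤ Real.exp (∑' j, ‖verblunsky μ j‖) * R ^ n := by
  have key : ∀ n, ‖(monicOP μ n).eval z‖ ≤ (∏ j ∈ Finset.range n, (1 + ‖verblunsky μ j‖)) * R ^ n ∧
      ‖(revOP μ n).eval z‖ ≤ (∏ j ∈ Finset.range n, (1 + ‖verblunsky μ j‖)) * R ^ n := by
    intro n
    induction n with
    | zero => simp [monicOP.eq_1 μ 0, revOP, revPoly, reflect_one]
    | succ n ih =>
      obtain ⟨h1, h2⟩ := ih
      rw [Finset.prod_range_succ, monicOP_succ hμ, eval_revOP_succ hμ]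
      set A := ∏ j ∈ Finset.range n, (1 + ‖verblunsky μ j‖)
      have hA : 0 ≤ A * R ^ n := (norm_nonneg _).trans h1
      have hα := norm_nonneg (verblunsky μ n)
      have h3 : ‖z * (monicOP μ n).eval z‖ ≤ A * R ^ n * R := by
        rw [norm_mul, mul_comm]
        exact mul_le_mul h1 hz (norm_nonneg _) hA
      constructor
      · simp only [eval_sub, eval_mul, eval_X, eval_C]
        refine (norm_sub_le _ _).trans ?_
        rw [norm_mul (conj _), RCLike.norm_conj, pow_succ]
        nlinarith [mul_le_mul_of_nonneg_left h2 hα, mul_nonneg hα hA,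
          mul_le_mul_of_nonneg_left hR (mul_nonneg hα hA)]
      · refine (norm_sub_le _ _).trans ?_
        rw [norm_mul (verblunsky μ n), pow_succ]
        nlinarith [mul_le_mul_of_nonneg_left h3 hα, mul_le_mul_of_nonneg_left hR hA]
  refine (key n).1.trans (mul_le_mul_of_nonneg_right ?_ (by positivity))
  refine (Real.prod_one_add_le_exp_sum _ (fun _ => norm_nonneg _)).trans (Real.exp_le_exp.2 ?_)
  exact hs.sum_le_tsum _ (fun _ _ => norm_nonneg _)

/-- On the closed unit disk `Φ_n` is dominated by `Φ_n^*`. -/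
lemma norm_eval_monicOP_le_revOP (hμ : IsNontrivialCircleMeasure μ) {z : ℂ} (hz : ‖z‖ ≤ 1)
    (n : ℕ) : ‖(monicOP μ n).eval z‖ ≤ ‖(revOP μ n).eval z‖ := by
  induction n with
  | zero => simp [monicOP.eq_1 μ 0, revOP, revPoly, reflect_one]
  | succ n ih =>
    rw [monicOP_succ hμ, eval_revOP_succ hμ]
    simp only [eval_sub, eval_mul, eval_X, eval_C]
    set u := z * (monicOP μ n).eval z with hu
    set v := (revOP μ n).eval z
    set a := verblunsky μ n
    have huv : ‖u‖ ≤ ‖v‖ := by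
      rw [hu, norm_mul]
      exact (mul_le_of_le_one_left (norm_nonneg _) hz).trans ih
    have ha : ‖a‖ < 1 := norm_verblunsky_lt_one hμ n
    -- The recursion preserves the sign of |Φ*|² - |zΦ|²: it acts by a matrix that is, up to
    -- scaling, in U(1,1).
    have hid : Complex.normSq (v - a * u) - Complex.normSq (u - conj a * v) =
        (1 - Complex.normSq a) * (Complex.normSq v - Complex.normSq u) := by
      simp only [Complex.normSq_apply, Complex.sub_re, Complex.sub_im, Complex.mul_re,
        Complex.mul_im, Complex.conj_re, Complex.conj_im]
      ring
    simp only [Complex.normSq_eq_norm_sq] at hid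
    refine (sq_le_sq₀ (norm_nonneg _) (norm_nonneg _)).1 ?_
    have h1 : ‖a‖ ^ 2 ≤ 1 := pow_le_one₀ (norm_nonneg _) ha.le
    have h2 : ‖u‖ ^ 2 ≤ ‖v‖ ^ 2 := pow_le_pow_left₀ (norm_nonneg _) huv 2
    nlinarith [mul_nonneg (sub_nonneg.2 h1) (sub_nonneg.2 h2)]

lemma one_sub_mul_norm_eval_revOP_le (hμ : IsNontrivialCircleMeasure μ) {z : ℂ} (hz : ‖z‖ ≤ 1)
    (n : ℕ) :
    (1 - ‖verblunsky μ n‖) * ‖(revOP μ n).eval z‖ ≤ ‖(revOP μ (n + 1)).eval z‖ := by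
  rw [eval_revOP_succ hμ]
  have h := norm_sub_norm_le ((revOP μ n).eval z) (verblunsky μ n * (z * (monicOP μ n).eval z))
  have h2 : ‖verblunsky μ n * (z * (monicOP μ n).eval z)‖ ≤
      ‖verblunsky μ n‖ * ‖(revOP μ n).eval z‖ := by
    rw [norm_mul, norm_mul]
    exact mul_le_mul_of_nonneg_left ((mul_le_of_le_one_left (norm_nonneg _) hz).trans
      (norm_eval_monicOP_le_revOP hμ hz n)) (norm_nonneg _)
  linarith

/-- Each step shrinks |Φ*_n| by at most the factor 1 - |α_n|, and summability keeps the product of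
these factors away from 0. -/
lemma limit_revOP_ne_zero (hμ : IsNontrivialCircleMeasure μ)
    (hs : Summable fun n => ‖verblunsky μ n‖) {z s : ℂ} (hz : ‖z‖ ≤ 1)
    (hlim : Tendsto (fun n => (revOP μ n).eval z) atTop (𝓝 s)) : s ≠ 0 := by
  have hpos : ∀ n, 0 < ‖(revOP μ n).eval z‖ := by
    intro n
    induction n with
    | zero => simp [monicOP.eq_1 μ 0, revOP, revPoly, reflect_one]
    | succ n ih =>
      exact (mul_pos (sub_pos.2 (norm_verblunsky_lt_one hμ n)) ih).trans_le
        (one_sub_mul_norm_eval_revOP_le hμ hz n)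
  -- From `N` on, ∏(1 - x_j) ≥ 1 - Σ x_j ≥ 1/2, so no infinite product is needed.
  obtain ⟨N, hN⟩ : ∃ N, ∑' j, ‖verblunsky μ (j + N)‖ < 1 / 2 :=
    ((tendsto_sum_nat_add fun n => ‖verblunsky μ n‖).eventually_lt_const
      (by norm_num : (0 : ℝ) < 1 / 2)).exists
  have hsN : Summable fun j => ‖verblunsky μ (j + N)‖ := (summable_nat_add_iff N).2 hs
  have hlow : ∀ m, ‖(revOP μ N).eval z‖ * (1 - ∑ j ∈ Finset.range m, ‖verblunsky μ (j + N)‖) ≤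
      ‖(revOP μ (m + N)).eval z‖ := by
    intro m
    induction m with
    | zero => simp
    | succ m ih =>
      have h1 := one_sub_mul_norm_eval_revOP_le hμ hz (m + N)
      have h2 := norm_verblunsky_lt_one hμ (m + N)
      rw [Finset.sum_range_succ, show m + 1 + N = m + N + 1 by ring]
      set t := ∑ j ∈ Finset.range m, ‖verblunsky μ (j + N)‖
      have ht : 0 ≤ t := Finset.sum_nonneg fun _ _ => norm_nonneg _
      have h3 := mul_le_mul_of_nonneg_left ih (sub_nonneg.2 h2.le)
      have h4 : 0 ≤ ‖(revOP μ N).eval z‖ * (‖verblunsky μ (m + N)‖ * t) := by positivity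
      nlinarith
  have hhalf : ‖(revOP μ N).eval z‖ / 2 ≤ ‖s‖ := by
    refine ge_of_tendsto ((hlim.comp (tendsto_add_atTop_nat N)).norm) (Eventually.of_forall ?_)
    intro m
    refine le_trans ?_ (hlow m)
    have : ∑ j ∈ Finset.range m, ‖verblunsky μ (j + N)‖ ≤ 1 / 2 :=
      (hsN.sum_le_tsum _ fun _ _ => norm_nonneg _).trans hN.le
    nlinarith [hpos N]
  exact norm_pos_iff.1 (lt_of_lt_of_le (half_pos (hpos N)) hhalf)

/-- The reversed polynomials converge geometrically on every closed disk inside `{|z| < 1 / b}`. -/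
lemma exists_limit_revOP (hμ : IsNontrivialCircleMeasure μ) {b : ℝ} (hb0 : 0 ≤ b) (hb : b < 1)
    (hα : Tendsto (fun n : ℕ => ‖verblunsky μ n‖ ^ (1 / (n : ℝ))) atTop (𝓝 b)) :
    ∃ S : ℂ → ℂ, (∀ z, ‖z‖ ≤ 1 → S z ≠ 0) ∧ S 0 = 1 ∧
      ∀ R, 1 ≤ R → b * R < 1 → ∃ K > 0, ∃ q, 0 < q ∧ q < 1 ∧
        ∀ n z, ‖z‖ ≤ R → ‖(revOP μ n).eval z - S z‖ ≤ K * q ^ n := by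
  have hs : Summable fun n => ‖verblunsky μ n‖ := by
    obtain ⟨β, h1, h2⟩ := exists_between hb
    obtain ⟨K, -, hK⟩ := exists_norm_le_mul_pow_of_tendsto_root h1 (hb0.trans_lt h1) hα
    exact Summable.of_nonneg_of_le (fun _ => norm_nonneg _) hK
      ((summable_geometric_of_lt_one (hb0.trans h1.le) h2).mul_left K)
  have hstep : ∀ R, 1 ≤ R → b * R < 1 → ∃ K > 0, ∃ q, 0 < q ∧ q < 1 ∧
        ∀ z, ‖z‖ ≤ R → ∀ n, dist ((revOP μ n).eval z) ((revOP μ (n + 1)).eval z) ≤ K * q ^ n := by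
    intro R hR hbR
    have hR0 : 0 < R := by linarith
    -- With b < β < 1/R, the decay β^n of α_n beats the growth R^n of Φ_n, and the ratio is βR < 1.
    obtain ⟨β, h1, h2⟩ := exists_between ((lt_div_iff₀ hR0).2 hbR)
    have hβ := hb0.trans_lt h1
    obtain ⟨K, hK0, hK⟩ := exists_norm_le_mul_pow_of_tendsto_root h1 hβ hα
    refine ⟨K * (R * Real.exp (∑' j, ‖verblunsky μ j‖)), by positivity, β * R, by positivity,
      (lt_div_iff₀ hR0).1 h2, fun z hz n => ?_⟩
    rw [dist_eq_norm, eval_revOP_succ hμ, sub_sub_cancel, norm_mul, norm_mul, mul_pow]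
    calc _ ≤ (K * β ^ n) * (R * (Real.exp (∑' j, ‖verblunsky μ j‖) * R ^ n)) := by
          gcongr
          · exact hK n
          · exact norm_eval_monicOP_le hμ hs hR hz n
      _ = _ := by ring
  -- The implication is inside the existential so that `S` is total; its values off {b|z| < 1} are
  -- irrelevant.
  have hex : ∀ z : ℂ, ∃ s, b * ‖z‖ < 1 → Tendsto (fun n => (revOP μ n).eval z) atTop (𝓝 s) := by
    intro z
    by_cases hz : b * ‖z‖ < 1
    · obtain ⟨K, -, q, -, hq, h⟩ := hstep (max 1 ‖z‖) (le_max_left _ _) (by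
        rw [mul_max_of_nonneg _ _ hb0, mul_one]; exact max_lt hb hz)
      obtain ⟨s, hs⟩ := cauchySeq_tendsto_of_complete
        (cauchySeq_of_le_geometric q K hq (h z (le_max_right _ _)))
      exact ⟨s, fun _ => hs⟩
    · exact ⟨0, fun h => absurd h hz⟩
  choose S hS using hex
  have hz1 : ∀ z : ℂ, ‖z‖ ≤ 1 → b * ‖z‖ < 1 := fun z hz =>
    (mul_le_of_le_one_right hb0 hz).trans_lt hb
  refine ⟨S, fun z hz => limit_revOP_ne_zero hμ hs hz (hS z (hz1 z hz)), ?_, ?_⟩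
  · have := hS 0 (by simp)
    simp only [eval_zero_revOP] at this
    exact (tendsto_nhds_unique this tendsto_const_nhds)
  · intro R hR hbR
    obtain ⟨K, hK, q, hq0, hq, h⟩ := hstep R hR hbR
    refine ⟨K / (1 - q), div_pos hK (sub_pos.2 hq), q, hq0, hq, fun n z hz => ?_⟩
    have := dist_le_of_le_geometric_of_tendsto q K hq (h z hz)
      (hS z ((mul_le_mul_of_nonneg_left hz hb0).trans_lt hbR)) n
    rw [dist_eq_norm] at this
    rwa [div_mul_eq_mul_div]

end

/-! ### Arc length, moments and the density of `μ`. -/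

instance isProbabilityMeasure_arcMeasure : IsProbabilityMeasure arcMeasure := by
  constructor
  rw [arcMeasure, Measure.smul_apply, Measure.map_apply (by fun_prop) MeasurableSet.univ]
  have h : (2 * Real.pi)⁻¹ * (2 * Real.pi) = 1 := inv_mul_cancel₀ (by positivity)
  simp only [Set.preimage_univ, Measure.restrict_apply_univ, Real.volume_Ioc, sub_zero,
    smul_eq_mul]
  rw [← ENNReal.ofReal_mul (by positivity), h, ENNReal.ofReal_one]

lemma arcMeasure_compl_sphere : arcMeasure (Metric.sphere (0 : ℂ) 1)ᶜ = 0 := by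
  rw [arcMeasure, Measure.smul_apply, Measure.map_apply (by fun_prop)
    Metric.isClosed_sphere.measurableSet.compl]
  have : circleMap 0 1 ⁻¹' (Metric.sphere (0 : ℂ) 1)ᶜ = ∅ := by
    ext θ; simp
  simp [this]

lemma integral_arcMeasure {f : ℂ → ℂ} (hf : ContinuousOn f (Metric.sphere (0 : ℂ) 1)) :
    ∫ ζ, f ζ ∂arcMeasure = Real.circleAverage f 0 1 := by
  have hm : AEStronglyMeasurable f arcMeasure :=
    (integrable_of_continuousOn_sphere arcMeasure_compl_sphere hf).aestronglyMeasurable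
  have hpos : ENNReal.ofReal (2 * Real.pi)⁻¹ ≠ 0 := by
    simp [Real.pi_pos]
  have hm' : AEStronglyMeasurable f
      ((volume.restrict (Set.Ioc (0 : ℝ) (2 * Real.pi))).map (circleMap 0 1)) := by
    rw [arcMeasure] at hm
    exact hm.mono_ac (Measure.absolutelyContinuous_smul hpos)
  rw [arcMeasure, integral_smul_measure, integral_map (by fun_prop) hm', Real.circleAverage_def,
    intervalIntegral.integral_of_le (by positivity), ENNReal.toReal_ofReal (by positivity)]

lemma integral_pow_arcMeasure (k : ℕ) : ∫ ζ, ζ ^ k ∂arcMeasure = if k = 0 then 1 else 0 := by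
  rw [integral_arcMeasure (by fun_prop), DiffContOnCl.circleAverage
    (Differentiable.diffContOnCl (by fun_prop)), zero_pow_eq]

/-- Finite measures on the unit circle are determined by their moments. -/
lemma measure_ext_of_moments {ν₁ ν₂ : Measure ℂ} [IsFiniteMeasure ν₁] [IsFiniteMeasure ν₂]
    (h₁ : ν₁ (Metric.sphere (0 : ℂ) 1)ᶜ = 0) (h₂ : ν₂ (Metric.sphere (0 : ℂ) 1)ᶜ = 0)
    (h : ∀ k : ℕ, ∫ ζ, ζ ^ k ∂ν₁ = ∫ ζ, ζ ^ k ∂ν₂) : ν₁ = ν₂ := by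
  have : Fact (0 < 2 * Real.pi) := ⟨Real.two_pi_pos⟩
  -- The measures are moved to `AddCircle` by the argument, where Fourier monomials span a dense
  -- subspace of the continuous functions, and moved back by `e`, a left inverse of `a` on the
  -- circle.
  let a : ℂ → AddCircle (2 * Real.pi) := fun ζ => (Complex.arg ζ : AddCircle (2 * Real.pi))
  have ha : Measurable a := AddCircle.measurable_mk'.comp Complex.measurable_arg
  let e : AddCircle (2 * Real.pi) → ℂ := fun x => fourier 1 x
  have he : Measurable e := (fourier 1).continuous.measurable
  have hfou : ∀ (n : ℤ) (ζ : ℂ), ‖ζ‖ = 1 → fourier n (a ζ) = ζ ^ n := by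
    intro n ζ hζ
    rw [fourier_coe_apply]
    have h1 : Complex.exp (Complex.arg ζ * Complex.I) = ζ := by
      simpa [hζ] using Complex.norm_mul_exp_arg_mul_I ζ
    conv_rhs => rw [← h1, ← Complex.exp_int_mul]
    congr 1
    have : (Real.pi : ℂ) ≠ 0 := by exact_mod_cast Real.pi_ne_zero
    push_cast
    field_simp
  have hz : ∀ n : ℤ, ∫ ζ, ζ ^ n ∂ν₁ = ∫ ζ, ζ ^ n ∂ν₂ := by
    intro n
    rcases Int.eq_nat_or_neg n with ⟨k, rfl | rfl⟩
    · simpa using h k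
    -- Negative moments are conjugates of positive ones, since 1/ζ = conj ζ on the circle.
    · have hc : ∀ ν : Measure ℂ, ν (Metric.sphere (0 : ℂ) 1)ᶜ = 0 →
          ∫ ζ, ζ ^ (-(k : ℤ)) ∂ν = conj (∫ ζ, ζ ^ k ∂ν) := by
        intro ν hν
        rw [← integral_conj]
        refine integral_congr_ae ?_
        filter_upwards [ae_norm_eq_one hν] with ζ hζ
        rw [zpow_neg, zpow_natCast, map_pow, ← inv_pow, Complex.inv_eq_conj hζ]
      rw [hc _ h₁, hc _ h₂, h k]
  have hback : ∀ ν : Measure ℂ, ν (Metric.sphere (0 : ℂ) 1)ᶜ = 0 → (ν.map a).map e = ν := by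
    intro ν hν
    rw [Measure.map_map he ha]
    conv_rhs => rw [← Measure.map_id (μ := ν)]
    refine Measure.map_congr ?_
    filter_upwards [ae_norm_eq_one hν] with ζ hζ
    simpa [e] using hfou 1 ζ hζ
  have hmain : ν₁.map a = ν₂.map a := by
    let Λ : (ν : Measure (AddCircle (2 * Real.pi))) → [IsFiniteMeasure ν] →
        C(AddCircle (2 * Real.pi), ℂ) →L[ℂ] ℂ := fun ν _ =>
      LinearMap.mkContinuous
        { toFun := fun g => ∫ x, g x ∂ν
          map_add' := fun g₁ g₂ => integral_add
            (g₁.continuous.integrable_of_hasCompactSupport (HasCompactSupport.of_compactSpace _))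
            (g₂.continuous.integrable_of_hasCompactSupport (HasCompactSupport.of_compactSpace _))
          map_smul' := fun c g => integral_const_mul c _ }
        (ν.real Set.univ) (fun g => by
          refine (norm_integral_le_of_norm_le_const
            (Eventually.of_forall g.norm_coe_le_norm)).trans_eq (mul_comm _ _))
    have hΛ : Λ (ν₁.map a) = Λ (ν₂.map a) := by
      refine ContinuousLinearMap.ext_on (s := Set.range (@fourier (2 * Real.pi))) ?_ ?_
      · exact Submodule.dense_iff_topologicalClosure_eq_top.2 span_fourier_closure_eq_top
      · rintro _ ⟨n, rfl⟩
        have hn : ∀ ν : Measure ℂ, ν (Metric.sphere (0 : ℂ) 1)ᶜ = 0 →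
            ∫ x, fourier n x ∂(ν.map a) = ∫ ζ, ζ ^ n ∂ν := by
          intro ν hν
          rw [integral_map ha.aemeasurable (fourier n).continuous.aestronglyMeasurable]
          refine integral_congr_ae ?_
          filter_upwards [ae_norm_eq_one hν] with ζ hζ using hfou n ζ hζ
        change ∫ x, fourier n x ∂(ν₁.map a) = ∫ x, fourier n x ∂(ν₂.map a)
        rw [hn _ h₁, hn _ h₂, hz n]
    refine ext_of_forall_integral_eq_of_IsFiniteMeasure fun f => ?_
    have hf := DFunLike.congr_fun hΛ ⟨fun x => (f x : ℂ), by fun_prop⟩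
    change ∫ x, (f x : ℂ) ∂(ν₁.map a) = ∫ x, (f x : ℂ) ∂(ν₂.map a) at hf
    rw [integral_complex_ofReal, integral_complex_ofReal] at hf
    exact_mod_cast hf
  rw [← hback ν₁ h₁, ← hback ν₂ h₂, hmain]

/-- If `h μ` has the moments of `A dθ/2π`, the density of `μ` is `A / h`. -/
lemma acDensity_ae_eq {μ : Measure ℂ} [IsFiniteMeasure μ]
    (hμ : μ (Metric.sphere (0 : ℂ) 1)ᶜ = 0) {h : ℂ → ℝ}
    (hc : ContinuousOn h (Metric.sphere (0 : ℂ) 1)) (hpos : ∀ ζ, ‖ζ‖ = 1 → 0 < h ζ) {A : ℝ}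
    (hA : 0 < A) (hmom : ∀ k : ℕ, ∫ ζ, (h ζ : ℂ) * ζ ^ k ∂μ = if k = 0 then (A : ℂ) else 0) :
    acDensity μ =ᵐ[arcMeasure] fun ζ => A / h ζ := by
  classical
  -- `h` is controlled only on the circle; cutting it off there makes it measurable on ℂ.
  let g : ℂ → ℝ := (Metric.sphere (0 : ℂ) 1).indicator h
  have hgm : Measurable g := by
    have := hc.measurable_piecewise (g := fun _ => (0 : ℝ)) continuousOn_const
      Metric.isClosed_sphere.measurableSet
    rwa [show (fun _ : ℂ => (0 : ℝ)) = 0 from rfl, Set.piecewise_eq_indicator] at this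
  have hg : ∀ ζ, ‖ζ‖ = 1 → g ζ = h ζ := fun ζ hζ => Set.indicator_of_mem (by simpa using hζ) h
  let f : ℂ → ENNReal := fun ζ => ENNReal.ofReal (g ζ)
  have hfm : Measurable f := hgm.ennreal_ofReal
  have hf0 : ∀ᵐ ζ ∂μ, f ζ ≠ 0 := by
    filter_upwards [ae_norm_eq_one hμ] with ζ hζ
    simpa [f, hg ζ hζ] using hpos ζ hζ
  have hgi : Integrable g μ := by
    refine (integrable_of_continuousOn_sphere hμ hc).congr ?_
    filter_upwards [ae_norm_eq_one hμ] with ζ hζ using (hg ζ hζ).symm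
  have : IsFiniteMeasure (μ.withDensity f) := isFiniteMeasure_withDensity_ofReal hgi.2
  have : IsFiniteMeasure (ENNReal.ofReal A • arcMeasure) :=
    Measure.smul_finite _ ENNReal.ofReal_ne_top
  have heq : μ.withDensity f = ENNReal.ofReal A • arcMeasure := by
    refine measure_ext_of_moments (withDensity_absolutelyContinuous μ f hμ)
      (by simp [arcMeasure_compl_sphere]) fun k => ?_
    rw [integral_withDensity_eq_integral_toReal_smul hfm
      (Eventually.of_forall fun _ => ENNReal.ofReal_lt_top), integral_smul_measure,
      integral_pow_arcMeasure, ENNReal.toReal_ofReal hA.le]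
    calc _ = ∫ ζ, (h ζ : ℂ) * ζ ^ k ∂μ := by
          refine integral_congr_ae ?_
          filter_upwards [ae_norm_eq_one hμ] with ζ hζ
          simp only [f]
          rw [hg ζ hζ, ENNReal.toReal_ofReal (hpos ζ hζ).le, Complex.real_smul]
      _ = _ := by rw [hmom k]; split_ifs <;> simp
  -- Dividing by the positive density shows that `μ` itself is absolutely continuous.
  have hμeq : μ = arcMeasure.withDensity (ENNReal.ofReal A • fun ζ => (f ζ)⁻¹) := by
    rw [withDensity_smul (f := fun ζ => (f ζ)⁻¹) _ hfm.inv, ← withDensity_smul_measure, ← heq,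
      withDensity_inv_same hfm hf0 (Eventually.of_forall fun _ => ENNReal.ofReal_ne_top)]
  have hrn := Measure.rnDeriv_withDensity arcMeasure
    (f := ENNReal.ofReal A • fun ζ => (f ζ)⁻¹) (hfm.inv.const_smul _)
  rw [← hμeq] at hrn
  filter_upwards [hrn, ae_norm_eq_one arcMeasure_compl_sphere] with ζ h1 h2
  rw [acDensity, h1]
  simp only [Pi.smul_apply, smul_eq_mul, f, hg ζ h2, ENNReal.toReal_mul, ENNReal.toReal_inv]
  rw [ENNReal.toReal_ofReal hA.le, ENNReal.toReal_ofReal (hpos ζ h2).le, div_eq_mul_inv]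

/-! ### The Schwarz formula and the Szegő function. -/

/-- **Schwarz integral formula** on the unit disk. -/
lemma integral_schwarz {r : ℝ} (hr : 1 < r) {H : ℂ → ℂ}
    (hH : DifferentiableOn ℂ H (Metric.ball 0 r)) (h0 : (H 0).im = 0) {z : ℂ} (hz : ‖z‖ < 1) :
    ∫ ζ, (ζ + z) / (ζ - z) * ((H ζ).re : ℂ) ∂arcMeasure = H z := by
  have hsub : Metric.closedBall (0 : ℂ) 1 ⊆ Metric.ball 0 r := Metric.closedBall_subset_ball hr
  have hcl : ∀ {F : ℂ → ℂ}, DifferentiableOn ℂ F (Metric.closedBall 0 1) →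
      DiffContOnCl ℂ F (Metric.ball 0 |1|) := by
    intro F hF
    rw [abs_one]
    exact DifferentiableOn.diffContOnCl (by rwa [closure_ball _ one_ne_zero])
  have hHd : DifferentiableOn ℂ H (Metric.closedBall 0 1) := hH.mono hsub
  have hHc : ContinuousOn H (Metric.sphere 0 1) :=
    hHd.continuousOn.mono Metric.sphere_subset_closedBall
  have hne : ∀ ζ : ℂ, ‖ζ‖ = 1 → ζ - z ≠ 0 := by
    intro ζ hζ h
    rw [sub_eq_zero.1 h] at hζ
    exact hz.ne hζ
  have hne' : ∀ ζ : ℂ, ‖ζ‖ ≤ 1 → 1 - ζ * conj z ≠ 0 := by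
    intro ζ hζ h
    have h1 : ‖ζ * conj z‖ = 1 := by rw [← sub_eq_zero.1 h, norm_one]
    rw [norm_mul, RCLike.norm_conj] at h1
    nlinarith [norm_nonneg ζ, norm_nonneg z]
  -- Write Re H = (H + conj H)/2. Against H the kernel is 2ζ/(ζ - z) - 1, handled by Cauchy's
  -- formula. Against conj H it equals, on the circle, the conjugate of a function of ζ analytic on
  -- the closed disk, so the mean value property applies to `Q`.
  let P : ℂ → ℂ := fun ζ => ζ / (ζ - z) * H ζ
  let Q : ℂ → ℂ := fun ζ => (1 + ζ * conj z) / (1 - ζ * conj z) * H ζ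
  have hPc : ContinuousOn P (Metric.sphere 0 1) :=
    (ContinuousOn.div (by fun_prop) (by fun_prop) fun ζ hζ => hne ζ (by simpa using hζ)).mul hHc
  have hQd : DifferentiableOn ℂ Q (Metric.closedBall 0 1) :=
    (DifferentiableOn.div (by fun_prop) (by fun_prop)
      fun ζ hζ => hne' ζ (by simpa using hζ)).mul hHd
  have hQc : ContinuousOn Q (Metric.sphere 0 1) :=
    hQd.continuousOn.mono Metric.sphere_subset_closedBall
  have hP : ∫ ζ, P ζ ∂arcMeasure = H z := by
    rw [integral_arcMeasure hPc]
    simpa [P] using (hcl hHd).circleAverage_smul_div (w := z) (by simpa using hz)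
  have hI : ∫ ζ, H ζ ∂arcMeasure = H 0 := by
    rw [integral_arcMeasure hHc, (hcl hHd).circleAverage]
  have hQ : ∫ ζ, conj (Q ζ) ∂arcMeasure = conj (H 0) := by
    rw [integral_conj, integral_arcMeasure hQc, (hcl hQd).circleAverage]
    simp [Q]
  have hreal : conj (H 0) = H 0 := Complex.conj_eq_iff_im.2 h0
  have hint := fun {F : ℂ → ℂ} (hF : ContinuousOn F (Metric.sphere 0 1)) =>
    integrable_of_continuousOn_sphere arcMeasure_compl_sphere hF
  have hQcc : ContinuousOn (fun ζ => conj (Q ζ)) (Metric.sphere 0 1) :=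
    Complex.continuous_conj.comp_continuousOn hQc
  calc _ = ∫ ζ, (P ζ - (1 / 2 : ℂ) * H ζ + (1 / 2 : ℂ) * conj (Q ζ)) ∂arcMeasure := by
        refine integral_congr_ae ?_
        filter_upwards [ae_norm_eq_one arcMeasure_compl_sphere] with ζ hζ
        have h1 : ζ * conj ζ = 1 := by
          rw [Complex.mul_conj, Complex.normSq_eq_norm_sq, hζ]; simp
        have h2 := hne ζ hζ
        have h3 : 1 - conj ζ * z ≠ 0 := by
          have := hne' ζ hζ.le
          intro h
          apply this
          have := congrArg conj h
          simpa using this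
        have h4 : (1 + conj ζ * z) / (1 - conj ζ * z) = (ζ + z) / (ζ - z) := by
          rw [div_eq_div_iff h3 h2]
          linear_combination (2 * z) * h1
        have h5 : ((H ζ).re : ℂ) = (H ζ + conj (H ζ)) / 2 := by
          rw [Complex.re_eq_add_conj]
        simp only [P, Q, map_mul, map_div₀, map_add, map_sub, map_one, Complex.conj_conj]
        rw [h4, h5]
        field_simp
        ring
    _ = H z := by
        have hsub : Integrable (fun ζ => P ζ - (1 / 2 : ℂ) * H ζ) arcMeasure :=
          (hint hPc).sub ((hint hHc).const_mul _)
        rw [integral_add hsub ((hint hQcc).const_mul _),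
          integral_sub (hint hPc) ((hint hHc).const_mul _), integral_const_mul,
          integral_const_mul, hP, hI, hQ, hreal]
        ring

/-- A zero-free analytic function on a disk, positive at the center, has an analytic logarithm
that is real at the center. -/
lemma exists_log_of_ne_zero {r : ℝ} (hr : 0 < r) {G : ℂ → ℂ}
    (hG : DifferentiableOn ℂ G (Metric.ball 0 r)) (hG0 : ∀ z ∈ Metric.ball (0 : ℂ) r, G z ≠ 0)
    {a : ℝ} (ha : 0 < a) (h0 : G 0 = a) :
    ∃ H : ℂ → ℂ, DifferentiableOn ℂ H (Metric.ball 0 r) ∧ (H 0).im = 0 ∧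
      ∀ z ∈ Metric.ball (0 : ℂ) r, Complex.exp (H z) = G z := by
  have hopen := Metric.isOpen_ball (x := (0 : ℂ)) (ε := r)
  obtain ⟨F, hF⟩ := ((hG.deriv hopen).div hG hG0).isExactOn_ball
  -- A primitive of G'/G, normalized at 0; then exp(H)/G has derivative 0.
  let H : ℂ → ℂ := fun z => F z - F 0 + Real.log a
  have hH : ∀ z ∈ Metric.ball (0 : ℂ) r, HasDerivAt H (deriv G z / G z) z := fun z hz =>
    ((hF z hz).sub_const _).add_const _
  refine ⟨H, fun z hz => (hH z hz).differentiableAt.differentiableWithinAt, by simp [H], ?_⟩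
  have hGd : ∀ z ∈ Metric.ball (0 : ℂ) r, HasDerivAt G (deriv G z) z := fun z hz =>
    ((hG z hz).differentiableAt (hopen.mem_nhds hz)).hasDerivAt
  have hQ : ∀ z ∈ Metric.ball (0 : ℂ) r, HasDerivAt (fun z => Complex.exp (H z) / G z) 0 z := by
    intro z hz
    have h1 := hG0 z hz
    have := (hH z hz).cexp.fun_div (hGd z hz) h1
    rwa [mul_assoc, div_mul_cancel₀ _ h1, sub_self, zero_div] at this
  have hmem : (0 : ℂ) ∈ Metric.ball (0 : ℂ) r := Metric.mem_ball_self hr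
  intro z hz
  have hconst := hopen.is_const_of_deriv_eq_zero (convex_ball (0 : ℂ) r).isPreconnected
    (fun w hw => (hQ w hw).differentiableAt.differentiableWithinAt)
    (fun w hw => (hQ w hw).deriv) hz hmem
  have h1 : Complex.exp (H 0) / G 0 = 1 := by
    rw [h0]
    simp only [H, sub_self, zero_add]
    rw [← Complex.ofReal_exp, Real.exp_log ha, div_self (by exact_mod_cast ha.ne')]
  simp only [h1] at hconst
  exact (div_eq_one_iff_eq (hG0 z hz)).1 hconst

/-- If the density of `μ` is `|G|⁻²` with `G` analytic and zero-free on a disk larger than the unit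
disk and `G 0 > 0`, then `D⁻¹ = G`. -/
lemma inv_szegoD_eq {μ : Measure ℂ} {r : ℝ} (hr : 1 < r) {G : ℂ → ℂ}
    (hG : DifferentiableOn ℂ G (Metric.ball 0 r)) (hG0 : ∀ z ∈ Metric.ball (0 : ℂ) r, G z ≠ 0)
    {a : ℝ} (ha : 0 < a) (h0 : G 0 = a)
    (hw : acDensity μ =ᵐ[arcMeasure] fun ζ => (‖G ζ‖ ^ 2)⁻¹) {z : ℂ} (hz : ‖z‖ < 1) :
    (szegoD μ z)⁻¹ = G z := by
  obtain ⟨H, hH, hH0, hexp⟩ := exists_log_of_ne_zero (by linarith) hG hG0 ha h0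
  -- With G = exp H, log w = -2 Re H on the circle. The factor 1/2 in D then gives D = exp(-H).
  have hint : ∫ ζ, (ζ + z) / (ζ - z) * (Real.log (acDensity μ ζ) : ℂ) ∂arcMeasure = -2 * H z := by
    rw [← integral_schwarz hr hH hH0 hz, ← integral_const_mul]
    refine integral_congr_ae ?_
    filter_upwards [hw, ae_norm_eq_one arcMeasure_compl_sphere] with ζ h1 h2
    have hlog : Real.log (acDensity μ ζ) = -2 * (H ζ).re := by
      rw [h1, Real.log_inv, Real.log_pow, ← hexp ζ (by simpa [h2] using hr), Complex.norm_exp,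
        Real.log_exp]
      push_cast
      ring
    rw [hlog]
    push_cast
    ring
  rw [szegoD, hint, ← Complex.exp_neg, ← hexp z (by simpa using hz.trans hr)]
  congr 1
  ring

lemma szegoCondition_of_acDensity {μ : Measure ℂ} {G : ℂ → ℂ}
    (hG : ContinuousOn G (Metric.sphere 0 1)) (hG0 : ∀ ζ, ‖ζ‖ = 1 → G ζ ≠ 0)
    (hw : acDensity μ =ᵐ[arcMeasure] fun ζ => (‖G ζ‖ ^ 2)⁻¹) : SzegoCondition μ := by
  constructor
  · filter_upwards [hw, ae_norm_eq_one arcMeasure_compl_sphere] with ζ h1 h2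
    rw [h1]
    have := norm_pos_iff.2 (hG0 ζ h2)
    positivity
  · have hne : ∀ ζ ∈ Metric.sphere (0 : ℂ) 1, ‖G ζ‖ ^ 2 ≠ 0 := fun ζ hζ =>
      pow_ne_zero _ (norm_ne_zero_iff.2 (hG0 ζ (by simpa using hζ)))
    have hc : ContinuousOn (fun ζ => Real.log ((‖G ζ‖ ^ 2)⁻¹)) (Metric.sphere (0 : ℂ) 1) :=
      ((hG.norm.pow 2).inv₀ hne).log fun ζ hζ => inv_ne_zero (hne ζ hζ)
    refine (integrable_of_continuousOn_sphere arcMeasure_compl_sphere hc).congr ?_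
    filter_upwards [hw] with ζ h1
    rw [h1]

/-! ### Orthogonality in the limit. -/

/-- The limit `S` of the reversed polynomials has `∫ |S|² ζ^k dμ = 0` for `k ≥ 1`. -/
lemma integral_limit_revOP {μ : Measure ℂ} (hμ : IsNontrivialCircleMeasure μ) {S : ℂ → ℂ}
    {K q : ℝ} (hq0 : 0 ≤ q) (hq : q < 1)
    (hS : ∀ n z, ‖z‖ ≤ 1 → ‖(revOP μ n).eval z - S z‖ ≤ K * q ^ n) {k : ℕ} (hk : 1 ≤ k) :
    ∫ ζ, ((‖S ζ‖ ^ 2 : ℝ) : ℂ) * ζ ^ k ∂μ = 0 := by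
  have := hμ.isProbabilityMeasure
  have hlim : ∀ z, ‖z‖ ≤ 1 → Tendsto (fun n => (revOP μ n).eval z) atTop (𝓝 (S z)) := by
    intro z hz
    rw [tendsto_iff_norm_sub_tendsto_zero]
    refine squeeze_zero (fun _ => norm_nonneg _) (fun n => hS n z hz) ?_
    simpa using (tendsto_pow_atTop_nhds_zero_of_lt_one hq0 hq).const_mul K
  have hK : 0 ≤ K := by simpa using (norm_nonneg _).trans (hS 0 0 (by simp))
  -- Since Φ*_0 = 1, the case `n = 0` of `hS` gives |S| ≤ K + 1.
  have hbd : ∀ n z, ‖z‖ ≤ 1 → ‖(revOP μ n).eval z‖ ≤ K + (K + 1) := by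
    intro n z hz
    have h1 : ‖(revOP μ n).eval z - S z‖ ≤ K :=
      (hS n z hz).trans (mul_le_of_le_one_right hK (pow_le_one₀ hq0 hq.le))
    have h2 : ‖(1 : ℂ) - S z‖ ≤ K := by
      simpa [monicOP.eq_1 μ 0, revOP, revPoly, reflect_one] using hS 0 z hz
    have h3 : ‖S z‖ ≤ K + 1 := by
      have := norm_sub_norm_le (S z) 1
      rw [norm_sub_rev, norm_one] at this
      linarith
    have := norm_sub_norm_le ((revOP μ n).eval z) (S z)
    linarith
  -- The index shift lets z^k Φ*_n, which vanishes at 0 and has degree at most n + k, fall in the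
  -- range where Φ*_{n+k} is orthogonal.
  have hzero : ∀ n, ∫ ζ, conj ((revOP μ (n + k)).eval ζ) * (X ^ k * revOP μ n).eval ζ ∂μ = 0 := by
    intro n
    refine polyInner_eq_zero_of_eval_zero hμ (m := n + k)
      (fun j h1 h2 => polyInner_revOP_X_pow hμ h1 h2) ?_ ?_
    · refine natDegree_mul_le.trans ?_
      have := natDegree_revOP_le μ n
      rw [natDegree_X_pow]
      omega
    · simp; omega
  have hconv : Tendsto
      (fun n => ∫ ζ, conj ((revOP μ (n + k)).eval ζ) * (X ^ k * revOP μ n).eval ζ ∂μ) atTop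
      (𝓝 (∫ ζ, ((‖S ζ‖ ^ 2 : ℝ) : ℂ) * ζ ^ k ∂μ)) := by
    refine tendsto_integral_of_dominated_convergence
      (fun _ => (K + (K + 1)) * (K + (K + 1)))
      (fun n => (integrable_polyInner hμ _ _).aestronglyMeasurable) (integrable_const _) ?_ ?_
    · intro n
      filter_upwards [ae_norm_eq_one hμ.carried_by_circle] with ζ hζ
      simp only [norm_mul, RCLike.norm_conj, eval_mul, eval_pow, eval_X, norm_pow, hζ, one_pow,
        one_mul]
      exact mul_le_mul (hbd _ _ hζ.le) (hbd _ _ hζ.le) (norm_nonneg _) (by linarith)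
    · filter_upwards [ae_norm_eq_one hμ.carried_by_circle] with ζ hζ
      have h1 := hlim ζ hζ.le
      have h2 := (Complex.continuous_conj.tendsto _).comp (h1.comp (tendsto_add_atTop_nat k))
      have h3 := h2.mul (h1.const_mul (ζ ^ k))
      have h4 : ((‖S ζ‖ ^ 2 : ℝ) : ℂ) * ζ ^ k = conj (S ζ) * (ζ ^ k * S ζ) := by
        rw [← Complex.normSq_eq_norm_sq, Complex.normSq_eq_conj_mul_self]
        ring
      rw [h4]
      simpa using h3
  simp only [hzero] at hconv
  exact tendsto_nhds_unique hconv tendsto_const_nhds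

/-! ### Argument principle, Rouché and quantitative Hurwitz. -/

open Metric in
lemma circleIntegral_sub_inv_of_notMem_closedBall {c w : ℂ} {R : ℝ} (hR : 0 ≤ R)
    (hw : w ∉ closedBall c R) : (∮ z in C(c, R), (z - w)⁻¹) = 0 := by
  have hne : ∀ z ∈ closedBall c R, z - w ≠ 0 := fun z hz h => hw (by rwa [← sub_eq_zero.1 h])
  refine Complex.circleIntegral_eq_zero_of_differentiable_on_off_countable hR
    Set.countable_empty ?_ ?_
  · exact ContinuousOn.inv₀ (by fun_prop) hne
  · intro z hz
    exact DifferentiableAt.inv (by fun_prop) (hne z (ball_subset_closedBall hz.1))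

open Metric in
/-- The argument principle for polynomials on a circle. -/
lemma circleIntegral_derivative_div {p : ℂ[X]} {c : ℂ} {R : ℝ} (hR : 0 < R)
    (hp : ∀ z ∈ sphere c R, p.eval z ≠ 0) :
    (∮ z in C(c, R), p.derivative.eval z / p.eval z) =
      2 * Real.pi * Complex.I * zeroCount p c R := by
  have hroot : ∀ a ∈ p.roots, a ∉ sphere c R := fun a ha h => hp a h (isRoot_of_mem_roots ha)
  have h1 : (∮ z in C(c, R), p.derivative.eval z / p.eval z) =
      ∮ z in C(c, R), (p.roots.map fun a => (z - a)⁻¹).sum := by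
    refine circleIntegral.integral_congr hR.le fun z hz => ?_
    have := (IsAlgClosed.splits p).eval_derivative_div_eval_of_ne_zero (hp z hz)
    simpa using this
  rw [h1, zeroCount]
  generalize p.roots = s at hroot
  induction s using Multiset.induction_on with
  | empty => simp [circleIntegral]
  | cons a s ih =>
    have hint : ∀ t : Multiset ℂ, (∀ a ∈ t, a ∉ sphere c R) →
        CircleIntegrable (fun z => (t.map fun a => (z - a)⁻¹).sum) c R := by
      intro t ht
      refine ContinuousOn.circleIntegrable hR.le ?_
      refine continuousOn_multiset_sum t fun a ha => ?_
      exact ContinuousOn.inv₀ (by fun_prop) fun z hz h =>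
        ht a ha (by rwa [← sub_eq_zero.1 h])
    have ha := hroot a (by simp)
    have hs : ∀ a ∈ s, a ∉ sphere c R := fun b hb => hroot b (by simp [hb])
    have hia : CircleIntegrable (fun z => (z - a)⁻¹) c R := by
      simpa using hint {a} (by simpa using ha)
    simp only [Multiset.map_cons, Multiset.sum_cons]
    rw [circleIntegral.integral_add hia (hint s hs), ih hs, Multiset.countP_cons]
    by_cases h : ‖a - c‖ < R
    · rw [circleIntegral.integral_sub_inv_of_mem_ball (by simpa [dist_eq_norm] using h), if_pos h]
      push_cast
      ring
    · rw [circleIntegral_sub_inv_of_notMem_closedBall hR.le, if_neg h]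
      · simp
      · intro hmem
        rw [mem_closedBall, dist_eq_norm] at hmem
        rw [mem_sphere, dist_eq_norm] at ha
        exact h (lt_of_le_of_ne hmem ha)

open Metric in
/-- **Rouché's theorem** for a polynomial `p` and a function `(z - c)^k g` with `g` analytic and
zero-free on the closed disk. -/
lemma zeroCount_eq_of_norm_sub_lt {p : ℂ[X]} {c : ℂ} {R : ℝ} (hR : 0 < R) {k : ℕ} {g : ℂ → ℂ}
    {U : Set ℂ} (hU : IsOpen U) (hRU : closedBall c R ⊆ U) (hg : DifferentiableOn ℂ g U)
    (hg0 : ∀ z ∈ closedBall c R, g z ≠ 0)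
    (hlt : ∀ z ∈ sphere c R, ‖p.eval z - (z - c) ^ k * g z‖ < ‖(z - c) ^ k * g z‖) :
    zeroCount p c R = k := by
  have hp : ∀ z ∈ sphere c R, p.eval z ≠ 0 := by
    intro z hz h
    have := hlt z hz
    simp [h] at this
  have hzc : ∀ z ∈ sphere c R, z - c ≠ 0 := by
    intro z hz h
    rw [mem_sphere, dist_eq_norm, h, norm_zero] at hz
    exact hR.ne hz
  have hgd : ∀ z ∈ closedBall c R, DifferentiableAt ℂ g z := fun z hz =>
    (hg z (hRU hz)).differentiableAt (hU.mem_nhds (hRU hz))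
  have hcont : ContinuousOn (fun z => deriv g z / g z) (closedBall c R) :=
    (((hg.deriv hU).continuousOn).mono hRU).div ((hg.continuousOn).mono hRU) hg0
  -- On the circle the quotient p/((z - c)^k g) lies within distance 1 of 1, so its principal
  -- logarithm is a primitive of the difference of the logarithmic derivatives.
  have hlog : (∮ z in C(c, R), (p.derivative.eval z / p.eval z -
      (k * (z - c)⁻¹ + deriv g z / g z))) = 0 := by
    refine circleIntegral.integral_eq_zero_of_hasDerivWithinAt hR.le
      (f := fun z => Complex.log (p.eval z / ((z - c) ^ k * g z))) fun z hz => ?_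
    have hz' := sphere_subset_closedBall hz
    have hf0 : (z - c) ^ k * g z ≠ 0 := mul_ne_zero (pow_ne_zero _ (hzc z hz)) (hg0 z hz')
    have hf : HasDerivAt (fun z => (z - c) ^ k * g z)
        (k * (z - c) ^ (k - 1) * g z + (z - c) ^ k * deriv g z) z := by
      simpa using (((hasDerivAt_id' z).sub_const c).fun_pow k).fun_mul (hgd z hz').hasDerivAt
    have hq := (p.hasDerivAt z).fun_div hf hf0
    have hslit : p.eval z / ((z - c) ^ k * g z) ∈ Complex.slitPlane := by
      refine Complex.ball_one_subset_slitPlane ?_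
      rw [mem_ball, dist_eq_norm, div_sub_one hf0, norm_div, div_lt_one (norm_pos_iff.2 hf0)]
      exact hlt z hz
    convert (hq.clog hslit).hasDerivWithinAt using 1
    have h1 := hp z hz
    have h2 := hzc z hz
    have h3 := hg0 z hz'
    rcases k with _ | k
    · simp
      field_simp
    · simp only [Nat.add_sub_cancel]
      push_cast
      field_simp
      ring
  have hgz : (∮ z in C(c, R), deriv g z / g z) = 0 := by
    refine Complex.circleIntegral_eq_zero_of_differentiable_on_off_countable hR.le
      Set.countable_empty hcont fun z hz => ?_
    have hz' := ball_subset_closedBall hz.1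
    exact ((hg.deriv hU z (hRU hz')).differentiableAt (hU.mem_nhds (hRU hz'))).div
      (hgd z hz') (hg0 z hz')
  have hi1 : CircleIntegrable (fun z => p.derivative.eval z / p.eval z) c R :=
    ContinuousOn.circleIntegrable hR.le (ContinuousOn.div (by fun_prop) (by fun_prop) hp)
  have hi2 : CircleIntegrable (fun z => (k : ℂ) * (z - c)⁻¹) c R :=
    ContinuousOn.circleIntegrable hR.le
      (continuousOn_const.mul (ContinuousOn.inv₀ (by fun_prop) hzc))
  have hi3 : CircleIntegrable (fun z => deriv g z / g z) c R :=
    (hcont.mono sphere_subset_closedBall).circleIntegrable hR.le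
  rw [circleIntegral.integral_sub hi1 (hi2.fun_add hi3), circleIntegral.integral_add hi2 hi3,
    circleIntegral_derivative_div hR hp, hgz, circleIntegral.integral_const_mul,
    circleIntegral.integral_sub_inv_of_mem_ball (mem_ball_self hR)] at hlog
  have h2pi := Complex.two_pi_I_ne_zero
  have : (2 * Real.pi * Complex.I : ℂ) * (zeroCount p c R - k) = 0 := by
    linear_combination hlog
  rcases mul_eq_zero.1 this with h | h
  · exact absurd h h2pi
  · exact_mod_cast sub_eq_zero.1 h

/-- Quantitative Hurwitz theorem: if `z^{-n} p_n` converges geometrically to `F` near a zero `z₀` of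
`F` of finite order, then as many zeros of `p_n` converge geometrically to `z₀`. -/
lemma exists_zeros_near {F : ℂ → ℂ} {z₀ : ℂ} (hz₀ : z₀ ≠ 0) (hF : AnalyticAt ℂ F z₀)
    (hF0 : F z₀ = 0) (hord : analyticOrderAt F z₀ ≠ ⊤) {p : ℕ → ℂ[X]} {K q : ℝ}
    (hq0 : 0 < q) (hq : q < 1)
    (happ : ∀ᶠ z in 𝓝 z₀, ∀ n, ‖(p n).eval z - z ^ n * F z‖ ≤ K * q ^ n * ‖z‖ ^ n) :
    ∃ δ > 0, ∃ ε > 0, ∃ N : ℕ, ∀ n ≥ N,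
      ((zeroCount (p n) z₀ δ : ℕ) : ℕ∞) = analyticOrderAt F z₀ ∧
      (∃ z : ℂ, (p n).eval z = 0 ∧ ‖z - z₀‖ < δ) ∧
      ∀ z : ℂ, (p n).eval z = 0 → ‖z - z₀‖ < δ → ‖z - z₀‖ ≤ Real.exp (-ε * n) := by
  set k := analyticOrderNatAt F z₀ with hk
  have hkord : (k : ℕ∞) = analyticOrderAt F z₀ := Nat.cast_analyticOrderNatAt hord
  have hkpos : 0 < k := by
    have : analyticOrderAt F z₀ ≠ 0 := hF.analyticOrderAt_ne_zero.2 hF0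
    rw [← hkord] at this
    exact Nat.pos_of_ne_zero (by exact_mod_cast this)
  obtain ⟨g, hg, hg0, hFg'⟩ := hF.analyticOrderAt_ne_top.1 hord
  have hFg : ∀ᶠ z in 𝓝 z₀, F z = (z - z₀) ^ k * g z := hFg'
  set m := ‖g z₀‖ / 2 with hm
  have hmpos : 0 < m := half_pos (norm_pos_iff.2 hg0)
  have hlow : ∀ᶠ z in 𝓝 z₀, m < ‖g z‖ :=
    hg.continuousAt.norm.eventually_const_lt (half_lt_self (norm_pos_iff.2 hg0))
  obtain ⟨ρ, hρ, hball⟩ := Metric.eventually_nhds_iff_ball.1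
    (happ.and (hFg.and (hg.eventually_analyticAt.and (hlow.and (eventually_ne_nhds hz₀)))))
  set δ := ρ / 2 with hδ
  have hδpos : 0 < δ := half_pos hρ
  have hδρ : Metric.closedBall z₀ δ ⊆ Metric.ball z₀ ρ :=
    Metric.closedBall_subset_ball (half_lt_self hρ)
  -- Split q^n = s^n s^n: one factor absorbs the constant K/m for large n, the other remains as the
  -- rate.
  set s := Real.sqrt q with hs
  have hs0 : 0 < s := Real.sqrt_pos.2 hq0
  have hs1 : s < 1 := by rw [hs, Real.sqrt_lt' one_pos]; simpa using hq
  have hsq : s * s = q := Real.mul_self_sqrt hq0.le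
  have hev1 : ∀ᶠ n : ℕ in atTop, K * q ^ n < δ ^ k * m := by
    have := (tendsto_pow_atTop_nhds_zero_of_lt_one hq0.le hq).const_mul K
    rw [mul_zero] at this
    exact this.eventually_lt_const (by positivity)
  have hev2 : ∀ᶠ n : ℕ in atTop, K * s ^ n < m := by
    have := (tendsto_pow_atTop_nhds_zero_of_lt_one hs0.le hs1).const_mul K
    rw [mul_zero] at this
    exact this.eventually_lt_const hmpos
  obtain ⟨N, hN⟩ := eventually_atTop.1 (hev1.and hev2)
  -- This ε makes exp(-εn)^k = s^n.
  refine ⟨δ, hδpos, -Real.log s / k,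
    div_pos (neg_pos.2 (Real.log_neg hs0 hs1)) (by exact_mod_cast hkpos), N, fun n hn => ?_⟩
  obtain ⟨hn1, hn2⟩ := hN n hn
  have hcount : zeroCount (p n) z₀ δ = k := by
    -- The comparison function is z^n F. The zero-free factor z^n joins `g`, and |z|^n cancels from
    -- both sides of the Rouché inequality.
    refine zeroCount_eq_of_norm_sub_lt hδpos (g := fun z => z ^ n * g z) Metric.isOpen_ball hδρ
      ?_ ?_ ?_
    · intro z hz
      exact (((differentiableAt_id).pow n).mul
        (hball z hz).2.2.1.differentiableAt).differentiableWithinAt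
    · intro z hz
      obtain ⟨-, -, -, h1, h2⟩ := hball z (hδρ hz)
      exact mul_ne_zero (pow_ne_zero _ h2) (norm_pos_iff.1 (hmpos.trans h1))
    · intro z hz
      obtain ⟨h1, h2, -, h3, h4⟩ := hball z (hδρ (Metric.sphere_subset_closedBall hz))
      have hzδ : ‖z - z₀‖ = δ := by simpa [dist_eq_norm] using hz
      have hzn : 0 < ‖z‖ ^ n := pow_pos (norm_pos_iff.2 h4) n
      have e : (z - z₀) ^ k * (z ^ n * g z) = z ^ n * F z := by
        rw [h2]; ring
      rw [e]
      refine (h1 n).trans_lt ?_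
      rw [h2, norm_mul, norm_mul, norm_pow, norm_pow, hzδ, mul_comm (‖z‖ ^ n)]
      refine mul_lt_mul_of_pos_right (hn1.trans ?_) hzn
      exact mul_lt_mul_of_pos_left h3 (by positivity)
  refine ⟨by rw [hcount, hkord], ?_, ?_⟩
  · have : 0 < zeroCount (p n) z₀ δ := hcount ▸ hkpos
    rw [zeroCount, Multiset.countP_pos] at this
    obtain ⟨z, hz, h⟩ := this
    exact ⟨z, isRoot_of_mem_roots hz, h⟩
  · intro z hz hzδ
    obtain ⟨h1, h2, -, h3, h4⟩ := hball z (hδρ (by simpa [dist_eq_norm] using hzδ.le))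
    have hzn : 0 < ‖z‖ ^ n := pow_pos (norm_pos_iff.2 h4) n
    have h5 := h1 n
    rw [hz, zero_sub, norm_neg, norm_mul, norm_pow, mul_comm (‖z‖ ^ n)] at h5
    have h6 : ‖z - z₀‖ ^ k * ‖g z‖ ≤ K * q ^ n := by
      have := le_of_mul_le_mul_right h5 hzn
      rwa [h2, norm_mul, norm_pow] at this
    have h7 : ‖z - z₀‖ ^ k ≤ s ^ n := by
      have hsn : 0 < s ^ n := pow_pos hs0 n
      have h8 : K * q ^ n ≤ m * s ^ n := by
        rw [← hsq, mul_pow, ← mul_assoc]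
        exact mul_le_mul_of_nonneg_right hn2.le hsn.le
      have h9 : ‖z - z₀‖ ^ k * m ≤ ‖z - z₀‖ ^ k * ‖g z‖ :=
        mul_le_mul_of_nonneg_left h3.le (by positivity)
      refine le_of_mul_le_mul_right (a := m) ?_ hmpos
      linarith
    refine (pow_le_pow_iff_left₀ (norm_nonneg _) (Real.exp_pos _).le hkpos.ne').1 (h7.trans_eq ?_)
    have hk0 : (k : ℝ) ≠ 0 := by exact_mod_cast hkpos.ne'
    rw [← Real.exp_nat_mul, show (k : ℝ) * (-(-Real.log s / k) * n) = n * Real.log s by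
      field_simp, Real.exp_nat_mul, Real.exp_log hs0]

/-! ### The disk {b|z| < 1} and reflection in the unit circle. -/

lemma exists_radius {b x : ℝ} (hb : b < 1) (hx : b * x < 1) :
    ∃ R, 1 ≤ R ∧ x < R ∧ b * R < 1 := by
  have h : b * max 1 x < 1 := by
    rcases max_choice 1 x with h | h <;> rw [h]
    · linarith
    · exact hx
  -- With M = max 1 x this choice gives 1 - bR = (1 - b)(1 - bM) > 0, also when b = 0.
  refine ⟨max 1 x + (1 - b * max 1 x), ?_, ?_, ?_⟩
  · linarith [le_max_left 1 x]
  · linarith [le_max_right 1 x]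
  · nlinarith

lemma isOpen_setOf_mul_norm_lt_one (b : ℝ) : IsOpen {z : ℂ | b * ‖z‖ < 1} :=
  isOpen_lt (by fun_prop) continuous_const

lemma isPreconnected_setOf_mul_norm_lt_one {b : ℝ} (hb : 0 ≤ b) :
    IsPreconnected {z : ℂ | b * ‖z‖ < 1} := by
  have h : ConvexOn ℝ Set.univ fun z : ℂ => b * ‖z‖ := (convexOn_norm convex_univ).smul hb
  have := (h.convex_lt 1).isPreconnected
  simpa using this

/-- `z ↦ conj (G (1 / conj z))` is analytic where `G` is analytic at `1 / conj z`. -/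
lemma analyticAt_conj_comp_inv_conj {U : Set ℂ} (hU : IsOpen U) {G : ℂ → ℂ}
    (hG : DifferentiableOn ℂ G U) {z₀ : ℂ} (hz₀ : z₀ ≠ 0) (hmem : 1 / conj z₀ ∈ U) :
    AnalyticAt ℂ (fun z => conj (G (1 / conj z))) z₀ := by
  let V : Set ℂ := {z | z ≠ 0} ∩ (fun z => 1 / conj z) ⁻¹' U
  have hc : ContinuousOn (fun z : ℂ => 1 / conj z) {z | z ≠ 0} :=
    ContinuousOn.div continuousOn_const (Complex.continuous_conj.continuousOn)
      fun z hz => by simpa using hz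
  have hV : IsOpen V := hc.isOpen_inter_preimage isOpen_ne hU
  refine DifferentiableOn.analyticAt (s := V) (fun z hz => ?_) (hV.mem_nhds ⟨hz₀, hmem⟩)
  have hinv : DifferentiableAt ℂ (fun z : ℂ => 1 / z) z :=
    DifferentiableAt.div (by fun_prop) (by fun_prop) hz.1
  have hU' : conj (1 / z) ∈ U := by simpa using hz.2
  -- The two conjugations pair up around `G`, leaving a holomorphic function composed with 1/z.
  have hGz : DifferentiableAt ℂ (conj ∘ G ∘ conj) (1 / z) := by
    have := (hG _ hU').differentiableAt (hU.mem_nhds hU')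
    simpa using this.conj_conj
  have := hGz.comp z hinv
  refine (this.congr_of_eventuallyEq (Eventually.of_forall fun w => ?_)).differentiableWithinAt
  simp

/-- Infinite order would, after reflection, make G vanish near 1/conj z₀, hence on the whole
connected disk, against G(0) ≠ 0. -/
lemma analyticOrderAt_conj_comp_inv_conj_ne_top {b : ℝ} (hb : 0 ≤ b) {G : ℂ → ℂ}
    (hG : DifferentiableOn ℂ G {z : ℂ | b * ‖z‖ < 1}) (hG0 : G 0 ≠ 0) {z₀ : ℂ} (hz₀ : b < ‖z₀‖) :
    analyticOrderAt (fun z => conj (G (1 / conj z))) z₀ ≠ ⊤ := by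
  intro h
  rw [analyticOrderAt_eq_top] at h
  have hne : z₀ ≠ 0 := norm_pos_iff.1 (hb.trans_lt hz₀)
  have hne' : (1 : ℂ) / conj z₀ ≠ 0 := by simpa using hne
  have hmem : 1 / conj z₀ ∈ {z : ℂ | b * ‖z‖ < 1} := by
    simp only [Set.mem_ofPred_eq, norm_div, norm_one, RCLike.norm_conj]
    rw [mul_one_div, div_lt_one (norm_pos_iff.2 hne)]
    exact hz₀
  have hcont : Tendsto (fun w : ℂ => 1 / conj w) (𝓝 (1 / conj z₀)) (𝓝 z₀) := by
    have : ContinuousAt (fun w : ℂ => 1 / conj w) (1 / conj z₀) :=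
      ContinuousAt.div continuousAt_const Complex.continuous_conj.continuousAt (by simpa using hne)
    simpa [ContinuousAt] using this
  have hzero : ∀ᶠ w in 𝓝 (1 / conj z₀), G w = 0 := by
    filter_upwards [hcont.eventually h] with w hw
    simpa using hw
  have hGa := hG.analyticOnNhd (isOpen_setOf_mul_norm_lt_one b)
  have := hGa.eqOn_zero_of_preconnected_of_eventuallyEq_zero
    (isPreconnected_setOf_mul_norm_lt_one hb) hmem hzero
  exact hG0 (this (by simp))

lemma zeroCount_C_mul {c : ℂ} (hc : c ≠ 0) (p : ℂ[X]) (z₀ : ℂ) (δ : ℝ) :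
    zeroCount (C c * p) z₀ δ = zeroCount p z₀ δ := by
  rw [zeroCount, zeroCount, roots_C_mul _ hc]

lemma differentiableOn_limit_revOP {μ : Measure ℂ} {b : ℝ} (hb : b < 1) {S : ℂ → ℂ}
    (hS : ∀ R, 1 ≤ R → b * R < 1 → ∃ K > 0, ∃ q, 0 < q ∧ q < 1 ∧
        ∀ n z, ‖z‖ ≤ R → ‖(revOP μ n).eval z - S z‖ ≤ K * q ^ n) :
    DifferentiableOn ℂ S {z : ℂ | b * ‖z‖ < 1} := by
  intro z hz
  obtain ⟨R, hR1, hzR, hbR⟩ := exists_radius hb hz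
  obtain ⟨K, hK, q, hq0, hq, h⟩ := hS R hR1 hbR
  have hu : TendstoUniformlyOn (fun n z => (revOP μ n).eval z) S atTop (Metric.ball 0 R) := by
    rw [Metric.tendstoUniformlyOn_iff]
    intro ε hε
    have := (tendsto_pow_atTop_nhds_zero_of_lt_one hq0.le hq).const_mul K
    rw [mul_zero] at this
    filter_upwards [this.eventually_lt_const hε] with n hn w hw
    rw [dist_comm, dist_eq_norm]
    exact (h n w (by simpa using (Metric.mem_ball.1 hw).le)).trans_lt hn
  have hd := hu.tendstoLocallyUniformlyOn.differentiableOn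
    (Eventually.of_forall fun n => (revOP μ n).differentiable.differentiableOn) Metric.isOpen_ball
  exact ((hd z (by simpa using hzR)).differentiableAt
    (Metric.isOpen_ball.mem_nhds (by simpa using hzR))).differentiableWithinAt

/-! ### Identification of the limit with D⁻¹, and the zeros near z₀. -/

/-- Geometric decay of the Verblunsky coefficients gives the Szegő condition, and `D⁻¹` continues
analytically as the limit of the rescaled reversed polynomials. -/
lemma exists_szegoInvContinuation {μ : Measure ℂ} (hμ : IsNontrivialCircleMeasure μ) {b : ℝ}
    (hb0 : 0 ≤ b) (hb : b < 1)
    (hα : Tendsto (fun n : ℕ => ‖verblunsky μ n‖ ^ (1 / (n : ℝ))) atTop (𝓝 b)) :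
    SzegoCondition μ ∧ ∃ (G : ℂ → ℂ) (a : ℂ), a ≠ 0 ∧ IsSzegoInvContinuation μ b G ∧ G 0 ≠ 0 ∧
      ∀ R, 1 ≤ R → b * R < 1 → ∃ K > 0, ∃ q, 0 < q ∧ q < 1 ∧
        ∀ n z, ‖z‖ ≤ R → ‖a * (revOP μ n).eval z - G z‖ ≤ K * q ^ n := by
  have hprob := hμ.isProbabilityMeasure
  obtain ⟨S, hS0, hS1, hS⟩ := exists_limit_revOP hμ hb0 hb hα
  have hSd := differentiableOn_limit_revOP hb hS
  have hopen := isOpen_setOf_mul_norm_lt_one b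
  have hball : Metric.closedBall (0 : ℂ) 1 ⊆ {z : ℂ | b * ‖z‖ < 1} := fun z hz =>
    (mul_le_of_le_one_right hb0 (by simpa using hz)).trans_lt hb
  have hSc : ContinuousOn S (Metric.sphere 0 1) :=
    hSd.continuousOn.mono (Metric.sphere_subset_closedBall.trans hball)
  have hhc : ContinuousOn (fun ζ => ‖S ζ‖ ^ 2) (Metric.sphere 0 1) := hSc.norm.pow 2
  have hhpos : ∀ ζ : ℂ, ‖ζ‖ = 1 → 0 < ‖S ζ‖ ^ 2 := fun ζ hζ =>
    pow_pos (norm_pos_iff.2 (hS0 ζ hζ.le)) 2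
  set A := ∫ ζ, ‖S ζ‖ ^ 2 ∂μ with hA
  have hApos : 0 < A := by
    refine lt_of_le_of_ne (integral_nonneg fun _ => by positivity) fun h => ?_
    have h1 := (integral_eq_zero_iff_of_nonneg (fun _ => by positivity)
      (integrable_of_continuousOn_sphere hμ.carried_by_circle hhc)).1 h.symm
    have h2 : ∀ᵐ ζ ∂μ, False := by
      filter_upwards [h1, ae_norm_eq_one hμ.carried_by_circle] with ζ h3 h4
      exact (hhpos ζ h4).ne' h3
    exact IsProbabilityMeasure.ne_zero μ (by simpa using h2)
  have hw : acDensity μ =ᵐ[arcMeasure] fun ζ => A / ‖S ζ‖ ^ 2 := by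
    refine acDensity_ae_eq hμ.carried_by_circle hhc hhpos hApos fun k => ?_
    split_ifs with hk
    · subst hk
      simp only [pow_zero, mul_one]
      rw [integral_complex_ofReal]
    · obtain ⟨K, -, q, hq0, hq, h⟩ := hS 1 le_rfl (by simpa using hb)
      exact integral_limit_revOP hμ hq0.le hq h (Nat.one_le_iff_ne_zero.2 hk)
  -- Dividing S by √A turns w = A/|S|² into |G|⁻² and keeps G(0) positive, as D(0) > 0 demands.
  set c := Real.sqrt A with hc
  have hcpos : 0 < c := Real.sqrt_pos.2 hApos
  have hc0 : (c : ℂ) ≠ 0 := by exact_mod_cast hcpos.ne'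
  let G : ℂ → ℂ := fun z => (c : ℂ)⁻¹ * S z
  have hGd : DifferentiableOn ℂ G {z : ℂ | b * ‖z‖ < 1} := hSd.const_mul _
  have hG0 : ∀ z : ℂ, ‖z‖ ≤ 1 → G z ≠ 0 := fun z hz => mul_ne_zero (inv_ne_zero hc0) (hS0 z hz)
  have hwG : acDensity μ =ᵐ[arcMeasure] fun ζ => (‖G ζ‖ ^ 2)⁻¹ := by
    filter_upwards [hw] with ζ hζ
    have : A = c ^ 2 := (Real.sq_sqrt hApos.le).symm
    rw [hζ, this]
    simp only [G, norm_mul, norm_inv, Complex.norm_real, Real.norm_eq_abs, abs_of_pos hcpos]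
    field_simp
  -- By compactness, zero-freeness on the closed disk extends slightly beyond it, so that log G is
  -- analytic across the circle.
  obtain ⟨r, hr1, hrsub, hr0⟩ : ∃ r > 1, Metric.ball (0 : ℂ) r ⊆ {z : ℂ | b * ‖z‖ < 1} ∧
      ∀ z ∈ Metric.ball (0 : ℂ) r, G z ≠ 0 := by
    have hU : IsOpen ({z : ℂ | b * ‖z‖ < 1} ∩ G ⁻¹' {0}ᶜ) :=
      hGd.continuousOn.isOpen_inter_preimage hopen isOpen_compl_singleton
    obtain ⟨t, ht, hsub⟩ := (isCompact_closedBall (0 : ℂ) 1).exists_thickening_subset_open hU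
      fun z hz => ⟨hball hz, hG0 z (by simpa using hz)⟩
    rw [thickening_closedBall ht zero_le_one] at hsub
    exact ⟨t + 1, by linarith, fun z hz => (hsub hz).1, fun z hz => (hsub hz).2⟩
  have hGzero : G 0 = ((c⁻¹ : ℝ) : ℂ) := by simp [G, hS1]
  refine ⟨szegoCondition_of_acDensity (continuousOn_const.mul hSc) (fun ζ hζ => hG0 ζ hζ.le) hwG,
    G, (c : ℂ)⁻¹, inv_ne_zero hc0, ⟨hGd, fun z hz =>
      (inv_szegoD_eq hr1 (hGd.mono hrsub) hr0 (inv_pos.2 hcpos) hGzero hwG hz).symm⟩,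
    hG0 0 (by simp), fun R hR hbR => ?_⟩
  obtain ⟨K, hK, q, hq0, hq, h⟩ := hS R hR hbR
  refine ⟨c⁻¹ * K, mul_pos (inv_pos.2 hcpos) hK, q, hq0, hq, fun n z hz => ?_⟩
  rw [← mul_sub, norm_mul, norm_inv, Complex.norm_real, Real.norm_eq_abs, abs_of_pos hcpos,
    mul_assoc]
  exact mul_le_mul_of_nonneg_left (h n z hz) (inv_pos.2 hcpos).le

/-- The zeros of the orthonormal polynomials near a Nevai–Totik zero. -/
lemma exists_zeros_orthonormalOP_near {μ : Measure ℂ} (hμ : IsNontrivialCircleMeasure μ) {b : ℝ}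
    (hb0 : 0 ≤ b) (hb : b < 1) {G : ℂ → ℂ} {a : ℂ} (ha : a ≠ 0)
    (hGd : DifferentiableOn ℂ G {z : ℂ | b * ‖z‖ < 1}) (hG0 : G 0 ≠ 0)
    (hS : ∀ R, 1 ≤ R → b * R < 1 → ∃ K > 0, ∃ q, 0 < q ∧ q < 1 ∧
      ∀ n z, ‖z‖ ≤ R → ‖a * (revOP μ n).eval z - G z‖ ≤ K * q ^ n)
    {z₀ : ℂ} (hz₀ : b < ‖z₀‖) (hzero : G (1 / conj z₀) = 0) :
    ∃ δ > 0, ∃ ε > 0, ∃ N : ℕ, ∀ n ≥ N,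
      ((zeroCount (orthonormalOP μ n) z₀ δ : ℕ) : ℕ∞) =
          analyticOrderAt (fun z : ℂ => conj (G (1 / conj z))) z₀ ∧
      (∃ z : ℂ, (orthonormalOP μ n).eval z = 0 ∧ ‖z - z₀‖ < δ) ∧
      ∀ z : ℂ, (orthonormalOP μ n).eval z = 0 → ‖z - z₀‖ < δ →
        ‖z - z₀‖ ≤ Real.exp (-ε * n) := by
  have ha' : conj a ≠ 0 := by simpa using ha
  have hz₀pos : 0 < ‖z₀‖ := hb0.trans_lt hz₀
  have hne : z₀ ≠ 0 := norm_pos_iff.1 hz₀pos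
  have hbz : b * ‖z₀‖⁻¹ < 1 := by
    rwa [← div_eq_mul_inv, div_lt_one hz₀pos]
  have hmem : 1 / conj z₀ ∈ {z : ℂ | b * ‖z‖ < 1} := by
    simpa using hbz
  obtain ⟨R, hR1, hzR, hbR⟩ := exists_radius hb hbz
  obtain ⟨K, -, q, hq0, hq, happ⟩ := hS R hR1 hbR
  -- The convergence of a Φ*_n on |z| ≤ R is reflected by z ↦ 1/conj z, which maps a neighbourhood
  -- of z₀ into that disk. The constants conj a and ‖Φ_n‖⁻¹ do not affect zeros.
  have hnear : ∀ᶠ z in 𝓝 z₀, ∀ n, ‖(C (conj a) * monicOP μ n).eval z -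
      z ^ n * conj (G (1 / conj z))‖ ≤ K * q ^ n * ‖z‖ ^ n := by
    have hcont : ContinuousAt (fun z : ℂ => ‖z‖⁻¹) z₀ :=
      continuousAt_id.norm.inv₀ hz₀pos.ne'
    filter_upwards [hcont.eventually_lt_const hzR, eventually_ne_nhds hne] with z hz hz0 n
    have hz' : (1 : ℂ) / conj z ≠ 0 := by simpa using hz0
    have h1 : (monicOP μ n).eval z = z ^ n * conj ((revOP μ n).eval (1 / conj z)) := by
      rw [eval_revOP hz']
      simp [hz0]
    have h2 := happ n (1 / conj z) (by simpa using hz.le)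
    have h3 : (C (conj a) * monicOP μ n).eval z - z ^ n * conj (G (1 / conj z)) =
        z ^ n * conj (a * (revOP μ n).eval (1 / conj z) - G (1 / conj z)) := by
      simp only [eval_mul, eval_C, h1, map_mul, map_sub]
      ring
    rw [h3, norm_mul, RCLike.norm_conj, norm_pow, mul_comm]
    exact mul_le_mul_of_nonneg_right h2 (by positivity)
  obtain ⟨δ, hδ, ε, hε, N, hN⟩ := exists_zeros_near hne
    (analyticAt_conj_comp_inv_conj (isOpen_setOf_mul_norm_lt_one b) hGd hne hmem)
    (by simpa using hzero)
    (analyticOrderAt_conj_comp_inv_conj_ne_top hb0 hGd hG0 hz₀)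
    hq0 hq hnear
  have hnorm : ∀ n, ((polyNorm μ (monicOP μ n) : ℂ)⁻¹) ≠ 0 := fun n => inv_ne_zero (by
    exact_mod_cast (Real.sqrt_pos.2 (integral_norm_sq_pos hμ (monicOP_ne_zero μ n))).ne')
  have hev : ∀ n z, (orthonormalOP μ n).eval z = 0 ↔ (C (conj a) * monicOP μ n).eval z = 0 := by
    intro n z
    have := hnorm n
    simp_all [orthonormalOP]
  refine ⟨δ, hδ, ε, hε, N, fun n hn => ?_⟩
  simp only [hev]
  rw [orthonormalOP, zeroCount_C_mul (hnorm n), ← zeroCount_C_mul ha']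
  exact hN n hn

end OPUC

theorem theorem4p4 (μ : Measure ℂ) (hμ : OPUC.IsNontrivialCircleMeasure μ)
    (b : ℝ) (hb : b < 1)
    (hα : Tendsto (fun n : ℕ => ‖OPUC.verblunsky μ n‖ ^ (1 / (n : ℝ))) atTop (𝓝 b)) :
    OPUC.SzegoCondition μ ∧
    ∃ Dinv : ℂ → ℂ, OPUC.IsSzegoInvContinuation μ b Dinv ∧
      ∀ z₀ : ℂ, b < ‖z₀‖ → Dinv (1 / conj z₀) = 0 →
        ∃ δ > 0, ∃ ε > 0, ∃ N : ℕ, ∀ n ≥ N,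
          ((OPUC.zeroCount (OPUC.orthonormalOP μ n) z₀ δ : ℕ) : ℕ∞) =
              analyticOrderAt (fun z : ℂ => conj (Dinv (1 / conj z))) z₀ ∧
          (∃ z : ℂ, (OPUC.orthonormalOP μ n).eval z = 0 ∧ ‖z - z₀‖ < δ) ∧
          ∀ z : ℂ, (OPUC.orthonormalOP μ n).eval z = 0 → ‖z - z₀‖ < δ →
            ‖z - z₀‖ ≤ Real.exp (-ε * n) := by
  -- Nonnegativity of `b` is automatic, as it is a limit of nonnegative reals.
  have hb0 : 0 ≤ b := ge_of_tendsto' hα fun n => Real.rpow_nonneg (norm_nonneg _) _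
  obtain ⟨hSz, G, a, ha, hG, hG0, hS⟩ := OPUC.exists_szegoInvContinuation hμ hb0 hb hα
  exact ⟨hSz, G, hG, fun z₀ hz₀ hzero =>
    OPUC.exists_zeros_orthonormalOP_near hμ hb0 hb ha hG.differentiableOn hG0 hS hz₀ hzero⟩
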